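/- **Theorem (Invariant measure and convergence of the instantaneous harmonic process).** Let $\omega, \mu, v > 0$, $\Sigma = \{-2, 0, 2\}$ and $E = [0, +\infty) \times \Sigma$. The instantaneous harmonic process is the $E$-valued process $X(t) = (x(t), \sigma(t))$ where $\sigma$ is the Markov jump process on $\Sigma$ that jumps from $2$ to $0$ and from $-2$ to $0$ at rate $2\omega$, and from $0$ to each of $2$ and $-2$ at rate $\omega$, and where, with $0 = T_0 < T_1 < \cdots$ the jump times of $\sigma$, $$x(t) = \max\left[0, \phi^{\sigma(T_n+)}_{t - T_n}(x(T_n))\right] \quad \text{for } t \in [T_n, T_{n+1}],$$ $\phi^\sigma$ being the flow of the ODE $\partial_t x = -2\mu x + v\sigma$. For a probability $\eta$ on $E$, let $\eta P_t$ be the law of $X(t)$ when $X(0) \sim \eta$. For probabilities $\eta, \tilde\eta$ on $E$ and $r, p \ge 1$, define, with values in $[0, +\infty]$, $$\mathcal W_p(\eta, \tilde\eta) = \inf\left\{ \left(\mathbb E|x - \tilde x|^p\right)^{1/p} + \mathbb P(\sigma \ne \tilde\sigma) : (x, \sigma) \sim \eta,\ (\tilde x, \tilde\sigma) \sim \tilde\eta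 \right\}, \qquad \mathcal F_r(\eta) = \left( \int \max(x, v/\mu)^r \, d\eta(x, \sigma) \right)^{1/r}.$$ (i) For all $1 \le p < q$, with $s > 1$ such that $\frac pq + \frac1s = 1$, all probabilities $\eta, \tilde\eta$ on $E$ and all $t \ge 0$, $$\mathcal W_p(\eta P_t, \tilde\eta P_t) \le \left(1 + 2^{1/s}\right)^{1/p} \left( \mathcal F_q(\eta) + \mathcal F_q(\tilde\eta) \right) \exp\left( -\frac{2\omega\mu/s}{\omega/s + p\mu}\, t \right) + 2 e^{-2\omega t}.$$ (ii) There is a unique probability $\pi$ on $E$ with $\pi P_t = \pi$ for all $t \ge 0$, and, for all $p, q, s$ as in (i), all probabilities $\eta$ on $E$ and all $t \ge 0$, $$\mathcal W_p(\eta P_t, \pi) \le \left(1 + 2^{1/s}\right)^{1/p} \left( \mathcal F_q(\eta) + \frac v\mu \right) \exp\left( -\frac{2\omega\mu/s}{\omega/s + p\mu}\, t \right) + 2 e^{-2\omega t}.$$ (iii) For all $p \ge 1$ and all $(x, \sigma) \in E$, $$\min\left(\mu, \frac\omega p\right) \le \varliminf_{t \to +\infty} -\frac1t \log \mathcal W_p\left(\delta_{(x,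 \sigma)} P_t, \pi\right).$$ -/

import Mathlib

open MeasureTheory ProbabilityTheory Filter
open scoped ENNReal NNReal

namespace HarmonicRTP

/-- The three values `-2`, `0`, `+2` of the relative velocity. -/
inductive Vel : Type
  | minus : Vel
  | zero : Vel
  | plus : Vel
  deriving DecidableEq

instance : Fintype Vel := ⟨{.minus, .zero, .plus}, fun σ => by cases σ <;> decide⟩

instance : MeasurableSpace Vel := ⊤

instance : DiscreteMeasurableSpace Vel := ⟨fun _ => trivial⟩

/-- The numerical value of a relative velocity. -/
def Vel.val : Vel → ℝ
  | .minus => -2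
  | .zero => 0
  | .plus => 2

/-- The transition-rate matrix of the relative velocity (instantaneous tumbles). -/
def rateMatrix (ω : ℝ) : Matrix Vel Vel ℝ
  | .plus, .plus => -2 * ω
  | .plus, .zero => 2 * ω
  | .plus, .minus => 0
  | .zero, .plus => ω
  | .zero, .zero => -2 * ω
  | .zero, .minus => ω
  | .minus, .plus => 0
  | .minus, .zero => 2 * ω
  | .minus, .minus => -2 * ω

/-- The state space `ℝ₊ × {-2, 0, 2}` of the pair (relative position, relative velocity). -/
abbrev State : Type := ℝ≥0 × Vel

/-- The flow of the ordinary differential equation `x' = -2 μ x + v σ`. -/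
noncomputable def flow (μ v : ℝ) (σ : Vel) (t x : ℝ) : ℝ :=
  v * σ.val / (2 * μ) + Real.exp (-2 * μ * t) * (x - v * σ.val / (2 * μ))

theorem flow_zero (μ v : ℝ) (σ : Vel) (x : ℝ) : flow μ v σ 0 x = x := by
  simp [flow]

theorem hasDerivAt_flow {μ : ℝ} (hμ : μ ≠ 0) (v : ℝ) (σ : Vel) (t x : ℝ) :
    HasDerivAt (fun r => flow μ v σ r x) (-2 * μ * flow μ v σ t x + v * σ.val) t := by
  have h1 : HasDerivAt (fun r : ℝ => -2 * μ * r) (-2 * μ) t := by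
    simpa using (hasDerivAt_id t).const_mul (-2 * μ)
  have h2 := (h1.exp.mul_const (x - v * σ.val / (2 * μ))).const_add (v * σ.val / (2 * μ))
  have h3 : Real.exp (-2 * μ * t) * (-2 * μ) * (x - v * σ.val / (2 * μ))
      = -2 * μ * flow μ v σ t x + v * σ.val := by
    unfold flow
    field_simp
    ring
  rw [← h3]
  exact h2

/-- Displacement of the jammed dynamics during a time `t` at constant velocity `σ`:
`max (0, φ_t^σ (x))`. -/
noncomputable def jammedFlow (μ v : ℝ) (σ : Vel) (t : ℝ) (x : ℝ≥0) : ℝ≥0 :=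
  ⟨max 0 (flow μ v σ t x), le_max_left _ _⟩

/-- The target of a velocity jump out of `σ`, given a fair coin. -/
def jumpTarget : Vel → Bool → Vel
  | .plus, _ => .zero
  | .minus, _ => .zero
  | .zero, true => .plus
  | .zero, false => .minus

/-- The law of a fair coin. -/
noncomputable def coin : Measure Bool := (PMF.uniformOfFintype Bool).toMeasure

instance : IsProbabilityMeasure coin := by unfold coin; infer_instance

/-- The jump out of `σ` has the transition probabilities `q_{σ, σ'} / (- q_{σ, σ})` of the
embedded chain of the rate matrix. -/
theorem coin_jumpTarget {ω : ℝ} (hω : 0 < ω) {σ σ' : Vel} (h : σ ≠ σ') :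
    coin {b | jumpTarget σ b = σ'}
      = ENNReal.ofReal (rateMatrix ω σ σ' / (-rateMatrix ω σ σ)) := by
  have hS : ∀ b : Bool, coin {b} = 2⁻¹ := by
    intro b
    rw [coin, PMF.toMeasure_apply_singleton _ _ (measurableSet_singleton b)]
    simp
  have h1 : ENNReal.ofReal (ω / (2 * ω)) = 2⁻¹ := by
    rw [show ω / (2 * ω) = 2⁻¹ by field_simp, ENNReal.ofReal_inv_of_pos (by norm_num)]
    simp
  have hm : {b : Bool | jumpTarget .zero b = .minus} = {false} := by
    ext b; cases b <;> simp [jumpTarget]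
  have hp : {b : Bool | jumpTarget .zero b = .plus} = {true} := by
    ext b; cases b <;> simp [jumpTarget]
  cases σ <;> cases σ'
  · exact absurd rfl h
  · simp only [jumpTarget, rateMatrix, Set.ofPred_true, measure_univ, neg_mul, neg_neg]
    rw [div_self (by positivity), ENNReal.ofReal_one]
  · simp [jumpTarget, rateMatrix]
  · rw [hm, hS]; simp only [rateMatrix, neg_mul, neg_neg, h1]
  · exact absurd rfl h
  · rw [hp, hS]; simp only [rateMatrix, neg_mul, neg_neg, h1]
  · simp [jumpTarget, rateMatrix]
  · simp only [jumpTarget, rateMatrix, Set.ofPred_true, measure_univ, neg_mul, neg_neg]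
    rw [div_self (by positivity), ENNReal.ofReal_one]
  · exact absurd rfl h

/-- The randomness driving the process: for every jump, a clock and a coin. -/
abbrev Noise : Type := ℕ → ℝ × Bool

instance : IsProbabilityMeasure (expMeasure 1) := isProbabilityMeasure_expMeasure one_pos

/-- Under the law of the noise, all clocks and coins are independent, the clocks being exponential
of rate one and the coins being fair. -/
noncomputable def noiseLaw : Measure Noise :=
  Measure.infinitePi (fun _ : ℕ => (expMeasure 1).prod coin)

instance : IsProbabilityMeasure noiseLaw := by unfold noiseLaw; infer_instance

/-- The time spent in the velocity `σ` before the next jump, `- q_{σ, σ}` being the total rate at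
which `σ` is left and `ξ` the exponential clock. -/
noncomputable def holdingTime (ω : ℝ) (σ : Vel) (ξ : ℝ) : ℝ := ξ / (-rateMatrix ω σ σ)

/-- The pair consisting of the `n`-th jump time `T_n` (with `T_0 = 0`) and of the state
`(x (T_n), σ (T_n +))`, for the initial state `z` and the noise `w`. -/
noncomputable def skeleton (ω μ v : ℝ) (z : State) (w : Noise) : ℕ → ℝ × State
  | 0 => (0, z)
  | n + 1 =>
    let T := (skeleton ω μ v z w n).1
    let x := (skeleton ω μ v z w n).2.1
    let σ := (skeleton ω μ v z w n).2.2
    (T + holdingTime ω σ (w n).1,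
      (jammedFlow μ v σ (holdingTime ω σ (w n).1) x, jumpTarget σ (w n).2))

/-- The index `n` such that `T_n ≤ t < T_{n+1}`, i.e. the number of jumps up to time `t`. -/
noncomputable def jumpCount (ω μ v : ℝ) (z : State) (w : Noise) (t : ℝ) : ℕ :=
  sInf {n : ℕ | t < (skeleton ω μ v z w (n + 1)).1}

/-- The instantaneous harmonic process at time `t`, started from `z`: the velocity is a Markov
jump process (built from its holding times and its embedded chain) and
`x (t) = max (0, φ_{t - T_n}^{σ (T_n +)} (x (T_n)))` for `T_n ≤ t < T_{n+1}`. -/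
noncomputable def process (ω μ v : ℝ) (z : State) (w : Noise) (t : ℝ) : State :=
  let s := skeleton ω μ v z w (jumpCount ω μ v z w t)
  (jammedFlow μ v s.2.2 (t - s.1) s.2.1, s.2.2)

/-- `η P_t`: the law at time `t` of the instantaneous harmonic process whose initial state has
law `η` and is independent of the noise. -/
noncomputable def evolve (ω μ v : ℝ) (η : Measure State) (t : ℝ) : Measure State :=
  (η.prod noiseLaw).map (fun p => process ω μ v p.1 p.2 t)

theorem measurable_skeleton (ω μ v : ℝ) (n : ℕ) :
    Measurable (fun p : State × Noise => skeleton ω μ v p.1 p.2 n) := by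
  induction n with
  | zero => exact measurable_const.prodMk measurable_fst
  | succ n ih =>
    have hval : Measurable Vel.val := measurable_of_countable _
    have hw : Measurable (fun p : State × Noise => p.2 n) :=
      (measurable_pi_apply n).comp measurable_snd
    have hσ := ih.snd.snd
    have hq : Measurable (fun σ : Vel => rateMatrix ω σ σ) := measurable_of_countable _
    have hH : Measurable (fun p : State × Noise =>
        holdingTime ω (skeleton ω μ v p.1 p.2 n).2.2 (p.2 n).1) :=
      hw.fst.div (hq.comp hσ).neg
    have hj : Measurable (fun q : Vel × Bool => jumpTarget q.1 q.2) := measurable_of_countable _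
    refine (ih.fst.add hH).prodMk (Measurable.prodMk ?_ (hj.comp (hσ.prodMk hw.snd)))
    refine Measurable.subtype_mk (measurable_const.max ?_)
    have hx := ih.snd.fst
    have hv := hval.comp hσ
    unfold flow
    simp only [Function.comp_def] at hv
    fun_prop

theorem measurable_process (ω μ v t : ℝ) :
    Measurable (fun p : State × Noise => process ω μ v p.1 p.2 t) := by
  have hval : Measurable Vel.val := measurable_of_countable _
  have hN : Measurable (fun p : State × Noise => jumpCount ω μ v p.1 p.2 t) := by
    have hlt : ∀ n, MeasurableSet
        {p : State × Noise | t < (skeleton ω μ v p.1 p.2 (n + 1)).1} := fun n =>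
      measurableSet_lt measurable_const (measurable_skeleton ω μ v (n + 1)).fst
    have h : ∀ p : State × Noise, ∀ k : ℕ, k < jumpCount ω μ v p.1 p.2 t ↔
        (∀ n ≤ k, ¬ t < (skeleton ω μ v p.1 p.2 (n + 1)).1) ∧
          ∃ n, t < (skeleton ω μ v p.1 p.2 (n + 1)).1 := by
      intro p k
      constructor
      · intro hk
        refine ⟨fun n hn hn' => ?_, ?_⟩
        · exact absurd (Nat.sInf_le (show n ∈ {n : ℕ | t < (skeleton ω μ v p.1 p.2 (n + 1)).1}
            from hn')) (not_le.2 (lt_of_le_of_lt hn hk))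
        · exact Nat.nonempty_of_pos_sInf (lt_of_le_of_lt (Nat.zero_le _) hk)
      · rintro ⟨h1, h2⟩
        by_contra hk
        exact h1 _ (not_lt.1 hk) (Nat.sInf_mem h2)
    refine measurable_of_Ioi fun k => ?_
    have : (fun p : State × Noise => jumpCount ω μ v p.1 p.2 t) ⁻¹' Set.Ioi k
        = (⋂ n, ⋂ _ : n ≤ k, {p | t < (skeleton ω μ v p.1 p.2 (n + 1)).1}ᶜ) ∩
          ⋃ n, {p | t < (skeleton ω μ v p.1 p.2 (n + 1)).1} := by
      ext p
      simpa using h p k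
    rw [this]
    exact (MeasurableSet.iInter fun n => MeasurableSet.iInter fun _ => (hlt n).compl).inter
      (MeasurableSet.iUnion hlt)
  have hS : Measurable (fun p : State × Noise =>
      skeleton ω μ v p.1 p.2 (jumpCount ω μ v p.1 p.2 t)) := by
    have : Measurable (fun q : ℕ × (State × Noise) => skeleton ω μ v q.2.1 q.2.2 q.1) :=
      measurable_from_prod_countable_right fun n => measurable_skeleton ω μ v n
    exact this.comp (hN.prodMk measurable_id)
  refine Measurable.prodMk (Measurable.subtype_mk (measurable_const.max ?_)) hS.snd.snd
  have hx := hS.snd.fst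
  have hv := hval.comp hS.snd.snd
  simp only [Function.comp_def] at hv
  unfold flow
  fun_prop

instance (ω μ v : ℝ) (η : Measure State) [IsProbabilityMeasure η] (t : ℝ) :
    IsProbabilityMeasure (evolve ω μ v η t) :=
  Measure.isProbabilityMeasure_map (measurable_process ω μ v t).aemeasurable

/-- `π` is an invariant probability of the instantaneous harmonic process. -/
def IsInvariantProbability (ω μ v : ℝ) (π : Measure State) : Prop :=
  IsProbabilityMeasure π ∧ ∀ t : ℝ, 0 ≤ t → evolve ω μ v π t = π

/-- The couplings of `η` and `η'`: the joint laws of two random states with laws `η`, `η'`. -/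
def couplings (η η' : Measure State) : Set (Measure (State × State)) :=
  {γ | γ.map Prod.fst = η ∧ γ.map Prod.snd = η'}

/-- The mixed Wasserstein / total variation distance: the infimum over all couplings of
`E[|x - x'|^p]^(1/p) + P(σ ≠ σ')`, as an extended nonnegative real. -/
noncomputable def mixedDist (p : ℝ) (η η' : Measure State) : ℝ≥0∞ :=
  ⨅ γ ∈ couplings η η',
    ((∫⁻ z, ENNReal.ofReal (|(z.1.1 : ℝ) - (z.2.1 : ℝ)| ^ p) ∂γ) ^ (1 / p)
      + γ {z | z.1.2 ≠ z.2.2})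

/-- `F_r(ν) = (∫ max(x, v/μ)^r dν(x, σ))^(1/r)`, as an extended nonnegative real. -/
noncomputable def momentF (μ v r : ℝ) (ν : Measure State) : ℝ≥0∞ :=
  (∫⁻ z, ENNReal.ofReal (max (z.1 : ℝ) (v / μ) ^ r) ∂ν) ^ (1 / r)

end HarmonicRTP

namespace HarmonicRTP

open scoped Topology BoundedContinuousFunction

/-! ### Paths -/

/-! Every velocity is left at the same rate `2 * ω`, so the jump times depend on the noise alone.
Two copies with equal velocities driven by the same noise keep equal velocities, and their positions
contract by `exp (-2 * μ * t)`, since clipping at `0` is 1-Lipschitz. In addition, `max x (v / μ)`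
never increases, because `v / μ` is the highest equilibrium of the flows.

If the velocities differ, a maximal coupling makes them agree at a prescribed time `t` except with
probability `exp (-2 * ω * t)` (`velocityProb_overlap`). This bound is conditional on the initial
states, so it multiplies the `p`-th moments directly and no Hölder inequality is needed. Using this
coupling on `[0, u]` and again on `[u, t]` (`exists_contracting_coupling`), with `u` balancing
mismatch against contraction, yields the rate `2ωμ / (ω + pμ)` with `p`-th moments
(`mixedDist_evolve_le`). The stated bound is weaker. The rate is the harmonic mean of `μ` and `ω /
p`, hence at least their minimum.

Composing the two stages requires the semigroup property of the explicit construction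
(`transition_add`), obtained from the memoryless clocks by induction on the number of jumps.

An invariant probability arises as a weak limit along an ultrafilter of laws carried by the compact
set `{x ≤ v / μ}`; its invariance follows from the Feller property and the contraction. Conversely
every invariant probability is carried by that set (`ae_le_of_invariant`), which gives uniqueness
and the value `v / μ` of its moment. Weak limits at vanishing mixed distance are identified by
comparing masses of half-lines (`eq_of_tendsto_of_mixedDist_tendsto`). -/

theorem holdingTime_eq (ω : ℝ) (σ : Vel) (ξ : ℝ) : holdingTime ω σ ξ = ξ / (2 * ω) := by
  cases σ <;> simp [holdingTime, rateMatrix]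

/-- The `n`-th jump time, which does not depend on the initial state. -/
noncomputable def jumpTime (ω : ℝ) (w : Noise) (n : ℕ) : ℝ :=
  ∑ i ∈ Finset.range n, (w i).1 / (2 * ω)

theorem skeleton_fst (ω μ v : ℝ) (z : State) (w : Noise) (n : ℕ) :
    (skeleton ω μ v z w n).1 = jumpTime ω w n := by
  induction n with
  | zero => simp [skeleton, jumpTime]
  | succ n ih =>
    simp only [skeleton, ih, holdingTime_eq]
    simp [jumpTime, Finset.sum_range_succ]

/-- The number of jumps up to time `t`. -/
noncomputable def numJumps (ω : ℝ) (w : Noise) (t : ℝ) : ℕ :=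
  sInf {n : ℕ | t < jumpTime ω w (n + 1)}

theorem jumpCount_eq (ω μ v : ℝ) (z : State) (w : Noise) (t : ℝ) :
    jumpCount ω μ v z w t = numJumps ω w t := by
  simp [jumpCount, numJumps, skeleton_fst]

theorem process_eq (ω μ v : ℝ) (z : State) (w : Noise) (t : ℝ) :
    process ω μ v z w t =
      (jammedFlow μ v (skeleton ω μ v z w (numJumps ω w t)).2.2
        (t - jumpTime ω w (numJumps ω w t)) (skeleton ω μ v z w (numJumps ω w t)).2.1,
        (skeleton ω μ v z w (numJumps ω w t)).2.2) := by
  simp only [process, jumpCount_eq, skeleton_fst]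

/-- Non-explosion is not needed: for an empty set `sInf` returns `0`, and `T_0 = 0 ≤ t`. -/
theorem jumpTime_numJumps_le (ω : ℝ) (w : Noise) {t : ℝ} (ht : 0 ≤ t) :
    jumpTime ω w (numJumps ω w t) ≤ t := by
  rcases h : numJumps ω w t with _ | n
  · simpa [jumpTime] using ht
  · by_contra hn
    have : numJumps ω w t ≤ n := Nat.sInf_le (not_le.1 hn)
    omega

theorem skeleton_vel_congr (ω μ v μ' v' : ℝ) {z z' : State} (h : z.2 = z'.2) (w : Noise) (n : ℕ) :
    (skeleton ω μ v z w n).2.2 = (skeleton ω μ' v' z' w n).2.2 := by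
  induction n with
  | zero => simpa [skeleton] using h
  | succ n ih => simp only [skeleton, ih]

/-- The velocity at time `t`, started from `σ`. -/
noncomputable def velocity (ω : ℝ) (σ : Vel) (w : Noise) (t : ℝ) : Vel :=
  (process ω 0 0 (0, σ) w t).2

theorem process_snd (ω μ v : ℝ) (z : State) (w : Noise) (t : ℝ) :
    (process ω μ v z w t).2 = velocity ω z.2 w t := by
  simp only [velocity, process_eq]
  exact skeleton_vel_congr ω μ v 0 0 (z := z) (z' := (0, z.2)) rfl w _

/-! ### Contraction of positions at equal velocities -/

theorem flow_sub_flow (μ v : ℝ) (σ : Vel) (t x y : ℝ) :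
    flow μ v σ t x - flow μ v σ t y = Real.exp (-2 * μ * t) * (x - y) := by
  unfold flow; ring

theorem abs_jammedFlow_sub_le (μ v : ℝ) (σ : Vel) (t : ℝ) (x y : ℝ≥0) :
    |(jammedFlow μ v σ t x : ℝ) - jammedFlow μ v σ t y|
      ≤ Real.exp (-2 * μ * t) * |(x : ℝ) - y| := by
  have h := abs_max_sub_max_le_abs (flow μ v σ t x) (flow μ v σ t y) 0
  rw [flow_sub_flow, abs_mul, abs_of_pos (Real.exp_pos _), max_comm, max_comm _ (0 : ℝ)] at h
  exact h

theorem abs_skeleton_sub_le (ω μ v : ℝ) {z z' : State} (h : z.2 = z'.2) (w : Noise) (n : ℕ) :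
    |((skeleton ω μ v z w n).2.1 : ℝ) - (skeleton ω μ v z' w n).2.1|
      ≤ Real.exp (-2 * μ * jumpTime ω w n) * |(z.1 : ℝ) - z'.1| := by
  induction n with
  | zero => simp [skeleton, jumpTime]
  | succ n ih =>
    simp only [skeleton]
    rw [skeleton_vel_congr ω μ v μ v h w n, holdingTime_eq]
    refine (abs_jammedFlow_sub_le ..).trans ?_
    refine (mul_le_mul_of_nonneg_left ih (Real.exp_pos _).le).trans (le_of_eq ?_)
    rw [← mul_assoc, ← Real.exp_add, jumpTime, jumpTime, Finset.sum_range_succ]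
    ring_nf

/-- The contraction exponents of the successive holding intervals telescope to `-2 * μ * t`,
whatever the signs of the clocks. -/
theorem abs_process_sub_le (ω μ v : ℝ) {z z' : State} (h : z.2 = z'.2) (w : Noise) (t : ℝ) :
    |((process ω μ v z w t).1 : ℝ) - (process ω μ v z' w t).1|
      ≤ Real.exp (-2 * μ * t) * |(z.1 : ℝ) - z'.1| := by
  simp only [process_eq]
  rw [skeleton_vel_congr ω μ v μ v h w]
  refine (abs_jammedFlow_sub_le ..).trans ?_
  refine (mul_le_mul_of_nonneg_left (abs_skeleton_sub_le ω μ v h w _)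
    (Real.exp_pos _).le).trans (le_of_eq ?_)
  rw [← mul_assoc, ← Real.exp_add]
  ring_nf

/-! ### Confinement by the highest equilibrium -/

theorem Vel.val_le_two (σ : Vel) : σ.val ≤ 2 := by cases σ <;> norm_num [Vel.val]

theorem jammedFlow_sub_le {μ v : ℝ} (hμ : 0 < μ) (hv : 0 < v) (σ : Vel) {t : ℝ} (ht : 0 ≤ t)
    (x : ℝ≥0) :
    (jammedFlow μ v σ t x : ℝ) - v / μ ≤ Real.exp (-2 * μ * t) * max 0 ((x : ℝ) - v / μ) := by
  have hE : 0 < Real.exp (-2 * μ * t) := Real.exp_pos _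
  have hE1 : Real.exp (-2 * μ * t) ≤ 1 := by
    rw [Real.exp_le_one_iff]; nlinarith [mul_nonneg hμ.le ht]
  have hvm : 0 < v / μ := by positivity
  have hs : v * σ.val / (2 * μ) ≤ v / μ := by
    rw [div_le_div_iff₀ (by positivity) hμ]
    nlinarith [mul_le_mul_of_nonneg_left σ.val_le_two (mul_pos hv hμ).le]
  change max 0 (flow μ v σ t x) - v / μ ≤ _
  rw [sub_le_iff_le_add]
  refine max_le (by positivity) ?_
  have h1 := mul_le_mul_of_nonneg_left (le_max_right 0 ((x : ℝ) - v / μ)) hE.le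
  unfold flow
  nlinarith [mul_nonneg (sub_nonneg.2 hE1) (sub_nonneg.2 hs)]

theorem max_zero_le_of_le_mul_max {a b e : ℝ} (he : 0 ≤ e) (h : a ≤ e * max 0 b) :
    max 0 a ≤ e * max 0 b := max_le (by positivity) h

theorem skeleton_sub_le {ω μ v : ℝ} (hω : 0 < ω) (hμ : 0 < μ) (hv : 0 < v) (z : State) {w : Noise}
    (hw : ∀ i, 0 ≤ (w i).1) (n : ℕ) :
    ((skeleton ω μ v z w n).2.1 : ℝ) - v / μ
      ≤ Real.exp (-2 * μ * jumpTime ω w n) * max 0 ((z.1 : ℝ) - v / μ) := by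
  induction n with
  | zero => simp [skeleton, jumpTime]
  | succ n ih =>
    simp only [skeleton]
    rw [holdingTime_eq]
    refine (jammedFlow_sub_le hμ hv _ (div_nonneg (hw n) (by positivity)) _).trans ?_
    refine (mul_le_mul_of_nonneg_left (max_zero_le_of_le_mul_max (Real.exp_pos _).le ih)
      (Real.exp_pos _).le).trans (le_of_eq ?_)
    rw [← mul_assoc, ← Real.exp_add, jumpTime, jumpTime, Finset.sum_range_succ]
    ring_nf

theorem process_sub_le {ω μ v : ℝ} (hω : 0 < ω) (hμ : 0 < μ) (hv : 0 < v) (z : State) {w : Noise}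
    (hw : ∀ i, 0 ≤ (w i).1) {t : ℝ} (ht : 0 ≤ t) :
    ((process ω μ v z w t).1 : ℝ) - v / μ
      ≤ Real.exp (-2 * μ * t) * max 0 ((z.1 : ℝ) - v / μ) := by
  simp only [process_eq]
  refine (jammedFlow_sub_le hμ hv _ (sub_nonneg.2 (jumpTime_numJumps_le ω w ht)) _).trans ?_
  refine (mul_le_mul_of_nonneg_left (max_zero_le_of_le_mul_max (Real.exp_pos _).le
    (skeleton_sub_le hω hμ hv z hw _)) (Real.exp_pos _).le).trans (le_of_eq ?_)
  rw [← mul_assoc, ← Real.exp_add]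
  ring_nf

theorem process_le_max {ω μ v : ℝ} (hω : 0 < ω) (hμ : 0 < μ) (hv : 0 < v) (z : State) {w : Noise}
    (hw : ∀ i, 0 ≤ (w i).1) {t : ℝ} (ht : 0 ≤ t) :
    ((process ω μ v z w t).1 : ℝ) ≤ max (z.1 : ℝ) (v / μ) := by
  have h := process_sub_le hω hμ hv z hw ht
  have hE1 : Real.exp (-2 * μ * t) ≤ 1 := by
    rw [Real.exp_le_one_iff]; nlinarith [mul_nonneg hμ.le ht]
  have h2 := mul_le_mul_of_nonneg_right hE1 (le_max_left 0 ((z.1 : ℝ) - v / μ))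
  have h3 : max 0 ((z.1 : ℝ) - v / μ) + v / μ = max (z.1 : ℝ) (v / μ) := by
    rw [← max_add_add_right]; simp [max_comm]
  linarith

/-- Clipping at an intermediate time is harmless: a flow line that reaches negative values has its
equilibrium at or below `0`, so it never comes back up. -/
theorem jammedFlow_jammedFlow {μ : ℝ} (hμ : 0 < μ) (v : ℝ) (σ : Vel) {s t : ℝ}
    (hs : 0 ≤ s) (ht : 0 ≤ t) (x : ℝ≥0) :
    jammedFlow μ v σ t (jammedFlow μ v σ s x) = jammedFlow μ v σ (s + t) x := by
  have hle : ∀ r : ℝ, 0 ≤ r → Real.exp (-2 * μ * r) ≤ 1 := fun r hr => by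
    rw [Real.exp_le_one_iff]; nlinarith [mul_nonneg hμ.le hr]
  have hf : flow μ v σ t (flow μ v σ s x) = flow μ v σ (s + t) x := by
    have : Real.exp (-2 * μ * (s + t)) = Real.exp (-2 * μ * t) * Real.exp (-2 * μ * s) := by
      rw [← Real.exp_add]; ring_nf
    unfold flow; rw [this]; ring
  have hmono : ∀ a b : ℝ, a ≤ b → flow μ v σ t a ≤ flow μ v σ t b := fun a b hab => by
    have := flow_sub_flow μ v σ t b a
    nlinarith [mul_nonneg (Real.exp_pos (-2 * μ * t)).le (sub_nonneg.2 hab)]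
  apply NNReal.coe_injective
  change max 0 (flow μ v σ t (max 0 (flow μ v σ s x))) = max 0 (flow μ v σ (s + t) x)
  rcases le_or_gt 0 (flow μ v σ s x) with h | h
  · rw [max_eq_right h, hf]
  · rw [max_eq_left h.le, ← hf]
    have hc : v * σ.val / (2 * μ) ≤ 0 := by
      by_contra hc
      have h1 := mul_nonneg (not_le.1 hc).le (sub_nonneg.2 (hle s hs))
      have h2 : 0 ≤ Real.exp (-2 * μ * s) * (x : ℝ) := mul_nonneg (Real.exp_pos _).le x.2
      unfold flow at h
      nlinarith
    have h0 : flow μ v σ t 0 ≤ 0 := by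
      have := mul_nonneg (neg_nonneg.2 hc) (sub_nonneg.2 (hle t ht))
      unfold flow
      nlinarith
    rw [max_eq_left h0, max_eq_left ((hmono _ _ h.le).trans h0)]

/-- The state after a first jump with clock and coin `a`. -/
noncomputable def firstJump (ω μ v : ℝ) (z : State) (a : ℝ × Bool) : State :=
  (jammedFlow μ v z.2 (a.1 / (2 * ω)) z.1, jumpTarget z.2 a.2)

/-- Prepend a clock and a coin to the noise. -/
def consNoise (a : ℝ × Bool) (w : Noise) : Noise
  | 0 => a
  | n + 1 => w n

theorem jumpTime_consNoise (ω : ℝ) (a : ℝ × Bool) (w : Noise) (n : ℕ) :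
    jumpTime ω (consNoise a w) (n + 1) = a.1 / (2 * ω) + jumpTime ω w n := by
  simp [jumpTime, Finset.sum_range_succ', consNoise, add_comm]

theorem skeleton_consNoise (ω μ v : ℝ) (z : State) (a : ℝ × Bool) (w : Noise) (n : ℕ) :
    (skeleton ω μ v z (consNoise a w) (n + 1)).2
      = (skeleton ω μ v (firstJump ω μ v z a) w n).2 := by
  induction n with
  | zero => simp [skeleton, firstJump, consNoise, holdingTime_eq]
  | succ n ih =>
    rw [skeleton]
    simp only [ih, holdingTime_eq]
    simp [skeleton, consNoise, holdingTime_eq]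

/-- The jump times of the noise are unbounded. -/
def NonExploding (ω : ℝ) (w : Noise) : Prop := ∀ t, ∃ n, t < jumpTime ω w (n + 1)

theorem numJumps_of_lt {ω : ℝ} {a : ℝ × Bool} {w : Noise} {t : ℝ} (h : t < a.1 / (2 * ω)) :
    numJumps ω (consNoise a w) t = 0 := by
  refine Nat.sInf_eq_zero.2 (Or.inl ?_)
  simpa [consNoise, jumpTime] using h

theorem numJumps_of_le {ω : ℝ} {a : ℝ × Bool} {w : Noise} {t : ℝ} (h : a.1 / (2 * ω) ≤ t)
    (hw : NonExploding ω w) :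
    numJumps ω (consNoise a w) t = numJumps ω w (t - a.1 / (2 * ω)) + 1 := by
  obtain ⟨n, hn⟩ := hw (t - a.1 / (2 * ω))
  have hmem : numJumps ω w (t - a.1 / (2 * ω)) ∈
      {n : ℕ | t - a.1 / (2 * ω) < jumpTime ω w (n + 1)} := Nat.sInf_mem ⟨n, hn⟩
  refine le_antisymm (Nat.sInf_le ?_) (le_csInf ⟨n + 1, ?_⟩ ?_)
  · simp only [Set.mem_ofPred_eq, jumpTime_consNoise] at hmem ⊢
    linarith
  · simp only [Set.mem_ofPred_eq, jumpTime_consNoise]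
    linarith
  · rintro (_ | m) hm
    · simp only [Set.mem_ofPred_eq, jumpTime_consNoise] at hm
      simp [jumpTime] at hm
      linarith
    · simp only [Set.mem_ofPred_eq, jumpTime_consNoise] at hm
      refine Nat.succ_le_succ (Nat.sInf_le ?_)
      simp only [Set.mem_ofPred_eq]
      linarith

theorem process_of_lt {ω μ v : ℝ} {z : State} {a : ℝ × Bool} {w : Noise} {t : ℝ}
    (h : t < a.1 / (2 * ω)) :
    process ω μ v z (consNoise a w) t = (jammedFlow μ v z.2 t z.1, z.2) := by
  rw [process_eq, numJumps_of_lt h]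
  simp [skeleton, jumpTime]

theorem process_of_le {ω μ v : ℝ} {z : State} {a : ℝ × Bool} {w : Noise} {t : ℝ}
    (h : a.1 / (2 * ω) ≤ t) (hw : NonExploding ω w) :
    process ω μ v z (consNoise a w) t
      = process ω μ v (firstJump ω μ v z a) w (t - a.1 / (2 * ω)) := by
  rw [process_eq, process_eq, numJumps_of_le h hw, skeleton_consNoise, jumpTime_consNoise,
    sub_add_eq_sub_sub]

/-- If no jump happens before `s`, the process restarts at time `s` with the residual clock. -/
theorem process_add_of_lt {ω μ : ℝ} (hω : 0 < ω) (hμ : 0 < μ) (v : ℝ) {z : State}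
    {a : ℝ × Bool} {w : Noise} {s t : ℝ} (hs : 0 ≤ s) (ht : 0 ≤ t) (h : s < a.1 / (2 * ω))
    (hw : NonExploding ω w) :
    process ω μ v z (consNoise a w) (s + t)
      = process ω μ v (jammedFlow μ v z.2 s z.1, z.2) (consNoise (a.1 - 2 * ω * s, a.2) w) t := by
  have hd : (a.1 - 2 * ω * s) / (2 * ω) = a.1 / (2 * ω) - s := by field_simp
  rcases lt_or_ge (s + t) (a.1 / (2 * ω)) with h1 | h1
  · rw [process_of_lt h1, process_of_lt (by rw [hd]; linarith), jammedFlow_jammedFlow hμ v _ hs ht]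
  · rw [process_of_le h1 hw, process_of_le (by simp only [hd]; linarith) hw]
    simp only [hd, firstJump]
    rw [jammedFlow_jammedFlow hμ v _ hs (by linarith)]
    rw [show s + (a.1 / (2 * ω) - s) = a.1 / (2 * ω) by ring,
      show t - (a.1 / (2 * ω) - s) = s + t - a.1 / (2 * ω) by ring]

/-! ### The noise -/

theorem measurable_consNoise :
    Measurable (fun p : (ℝ × Bool) × Noise => consNoise p.1 p.2) := by
  refine measurable_pi_iff.2 ?_
  rintro (_ | n)
  · exact measurable_fst
  · exact (measurable_pi_apply n).comp measurable_snd

/-- Both laws agree on finite cylinders. Padding the cylinder with `Set.univ` up to an initial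
segment of indices makes the shift by one coordinate explicit. -/
theorem map_consNoise :
    (((expMeasure 1).prod coin).prod noiseLaw).map (fun p => consNoise p.1 p.2) = noiseLaw := by
  refine Measure.eq_infinitePi _ fun s t ht => ?_
  classical
  obtain ⟨n, hn⟩ : ∃ n, s ⊆ Finset.range (n + 1) :=
    ⟨s.sup id, fun i hi => Finset.mem_range.2 (Nat.lt_succ_of_le (Finset.le_sup (f := id) hi))⟩
  let t' : ℕ → Set (ℝ × Bool) := fun i => if i ∈ s then t i else Set.univ
  have ht' : ∀ i, MeasurableSet (t' i) := fun i => by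
    simp only [t']; split_ifs; exacts [ht i, .univ]
  have hs : Set.pi (s : Set ℕ) t = Set.pi (Finset.range (n + 1) : Set ℕ) t' := by
    ext w
    simp only [Set.mem_pi, Finset.mem_coe, t']
    refine ⟨fun h i _ => ?_, fun h i hi => by simpa [hi] using h i (hn hi)⟩
    split_ifs with hi; exacts [h i hi, trivial]
  have hp : ∏ i ∈ s, ((expMeasure 1).prod coin) (t i)
      = ∏ i ∈ Finset.range (n + 1), ((expMeasure 1).prod coin) (t' i) := by
    rw [← Finset.prod_subset hn]
    · exact Finset.prod_congr rfl fun i hi => by simp [t', hi]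
    · intro i _ hi; simp [t', hi]
  have hpre : (fun p : (ℝ × Bool) × Noise => consNoise p.1 p.2) ⁻¹'
      Set.pi (Finset.range (n + 1) : Set ℕ) t'
      = t' 0 ×ˢ Set.pi (Finset.range n : Set ℕ) (fun i => t' (i + 1)) := by
    ext p
    simp only [Set.mem_preimage, Set.mem_pi, Finset.mem_coe, Finset.mem_range, Set.mem_prod]
    refine ⟨fun h => ⟨h 0 (by omega), fun i hi => h (i + 1) (by omega)⟩, ?_⟩
    rintro ⟨h0, h1⟩ (_ | i) hi
    · exact h0
    · exact h1 i (by omega)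
  rw [hp, hs, Measure.map_apply measurable_consNoise
    (.pi (Finset.countable_toSet _) fun i _ => ht' i), hpre, Measure.prod_prod,
    noiseLaw, Measure.infinitePi_pi _ (fun i _ => ht' _), Finset.prod_range_succ', mul_comm]

theorem lintegral_noiseLaw {f : Noise → ℝ≥0∞} (hf : Measurable f) :
    ∫⁻ w, f w ∂noiseLaw
      = ∫⁻ a, ∫⁻ w, f (consNoise a w) ∂noiseLaw ∂((expMeasure 1).prod coin) := by
  conv_lhs => rw [← map_consNoise]
  rw [lintegral_map hf measurable_consNoise]
  exact lintegral_prod _ (hf.comp measurable_consNoise).aemeasurable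

theorem expMeasure_eq (r : ℝ) : expMeasure r = volume.withDensity (exponentialPDF r) := rfl

theorem measurable_exponentialPDF (r : ℝ) : Measurable (exponentialPDF r) :=
  (measurable_exponentialPDFReal r).ennreal_ofReal

theorem expMeasure_Iic (x : ℝ) (hx : 0 ≤ x) :
    expMeasure 1 (Set.Iic x) = ENNReal.ofReal (1 - Real.exp (-x)) := by
  rw [← ofReal_measureReal, ← cdf_eq_real, cdf_expMeasure_eq one_pos]
  simp [hx]

theorem expMeasure_Ioi (x : ℝ) (hx : 0 ≤ x) :
    expMeasure 1 (Set.Ioi x) = ENNReal.ofReal (Real.exp (-x)) := by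
  rw [← Set.compl_Iic, prob_compl_eq_one_sub measurableSet_Iic, expMeasure_Iic x hx,
    ← ENNReal.ofReal_one, ← ENNReal.ofReal_sub _ (by simpa using hx)]
  simp

/-- The exponential law is memoryless. -/
theorem lintegral_expMeasure_residual {g : ℝ → ℝ≥0∞} (hg : Measurable g) {a : ℝ} (ha : 0 ≤ a) :
    ∫⁻ ξ, (Set.Ioi a).indicator (fun ξ => g (ξ - a)) ξ ∂(expMeasure 1)
      = ENNReal.ofReal (Real.exp (-a)) * ∫⁻ ξ, g ξ ∂(expMeasure 1) := by
  have hp := measurable_exponentialPDF 1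
  have hm : Measurable ((Set.Ioi a).indicator (fun ξ => g (ξ - a))) :=
    (hg.comp (measurable_id.sub_const a)).indicator measurableSet_Ioi
  rw [expMeasure_eq, lintegral_withDensity_eq_lintegral_mul _ hp hm,
    lintegral_withDensity_eq_lintegral_mul _ hp hg, ← lintegral_const_mul _ (hp.mul hg),
    ← lintegral_sub_right_eq_self
      (fun ξ => ENNReal.ofReal (Real.exp (-a)) * (exponentialPDF 1 * g) ξ) a]
  -- At `ξ = a` the two integrands may differ: the indicator of `Ioi a` vanishes while the shifted
  -- density equals `1`.
  have hae : ∀ᵐ ξ : ℝ, ξ ≠ a := by simp [ae_iff]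
  refine lintegral_congr_ae (hae.mono fun ξ hξ => ?_)
  simp only [Pi.mul_apply, Set.indicator_apply, Set.mem_Ioi]
  split_ifs with h
  · rw [exponentialPDF_of_nonneg (by linarith), exponentialPDF_of_nonneg (by linarith),
      ← mul_assoc, ← ENNReal.ofReal_mul (Real.exp_pos _).le]
    congr 2
    simp only [one_mul]
    rw [← Real.exp_add]; ring_nf
  · rw [exponentialPDF_of_neg (x := ξ - a) (by rcases lt_or_gt_of_ne hξ with h' | h' <;> grind)]
    simp

theorem lintegral_clock_residual {H : ℝ × Bool → ℝ≥0∞} (hH : Measurable H) {a : ℝ} (ha : 0 ≤ a) :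
    ∫⁻ b, {b : ℝ × Bool | a < b.1}.indicator (fun b => H (b.1 - a, b.2)) b
        ∂((expMeasure 1).prod coin)
      = ENNReal.ofReal (Real.exp (-a)) * ∫⁻ b, H b ∂((expMeasure 1).prod coin) := by
  have hm : Measurable ({b : ℝ × Bool | a < b.1}.indicator (fun b => H (b.1 - a, b.2))) :=
    (hH.comp ((measurable_fst.sub_const a).prodMk measurable_snd)).indicator
      (measurableSet_lt measurable_const measurable_fst)
  rw [lintegral_prod _ hm.aemeasurable, lintegral_prod _ hH.aemeasurable,
    ← lintegral_expMeasure_residual hH.lintegral_prod_right' ha]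
  refine lintegral_congr fun ξ => ?_
  by_cases h : a < ξ <;> simp [h]

theorem ae_clock_nonneg : ∀ᵐ w ∂noiseLaw, ∀ i, 0 ≤ (w i).1 := by
  refine ae_all_iff.2 fun i => ?_
  have h0 : ∀ᵐ ξ ∂(expMeasure 1), 0 ≤ ξ := by
    have := expMeasure_Iic 0 le_rfl
    rw [ae_iff]
    refine measure_mono_null (fun ξ hξ => ?_) (this.trans (by simp))
    simp at hξ ⊢; exact hξ.le
  have h1 : ∀ᵐ a ∂((expMeasure 1).prod coin), 0 ≤ a.1 :=
    Measure.quasiMeasurePreserving_fst.ae h0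
  exact (measurePreserving_eval_infinitePi (fun _ : ℕ => (expMeasure 1).prod coin)
    i).quasiMeasurePreserving.ae h1

/-- Clocks being nonnegative, a single clock beyond `2 * ω * t` pushes a jump time past `t`. Such a
clock exists almost surely, since `n` clocks all stay below `K` with probability `c ^ n`, `c < 1`.
-/
theorem ae_nonExploding {ω : ℝ} (hω : 0 < ω) : ∀ᵐ w ∂noiseLaw, NonExploding ω w := by
  have key : ∀ K : ℕ, ∀ᵐ w ∂noiseLaw, ∃ i, (K : ℝ) < (w i).1 := by
    intro K
    rw [ae_iff]
    have hc : expMeasure 1 (Set.Iic (K : ℝ)) < 1 := by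
      rw [expMeasure_Iic _ (Nat.cast_nonneg K)]
      exact ENNReal.ofReal_lt_one.2 (by linarith [Real.exp_pos (-(K : ℝ))])
    have hle : ∀ n : ℕ, noiseLaw {w | ¬ ∃ i, (K : ℝ) < (w i).1}
        ≤ (expMeasure 1 (Set.Iic (K : ℝ))) ^ n := by
      intro n
      have := Measure.infinitePi_pi (fun _ : ℕ => (expMeasure 1).prod coin)
        (s := Finset.range n) (t := fun _ => Set.Iic (K : ℝ) ×ˢ Set.univ)
        (fun _ _ => measurableSet_Iic.prod .univ)
      simp only [Measure.prod_prod, measure_univ, mul_one, Finset.prod_const,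
        Finset.card_range] at this
      rw [← this]
      refine measure_mono fun w hw => ?_
      simp only [not_exists, not_lt, Set.mem_ofPred_eq] at hw
      intro i _
      exact ⟨hw i, trivial⟩
    exact le_antisymm (ge_of_tendsto' (ENNReal.tendsto_pow_atTop_nhds_zero_of_lt_one hc) hle)
      zero_le
  filter_upwards [ae_all_iff.2 key, ae_clock_nonneg] with w hw h0 t
  obtain ⟨K, hK⟩ := exists_nat_gt (2 * ω * t)
  obtain ⟨i, hi⟩ := hw K
  refine ⟨i, ?_⟩
  have h1 : (w i).1 / (2 * ω) ≤ jumpTime ω w (i + 1) :=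
    Finset.single_le_sum (f := fun i => (w i).1 / (2 * ω))
      (fun j _ => div_nonneg (h0 j) (by positivity)) (Finset.self_mem_range_succ i)
  refine lt_of_lt_of_le ?_ h1
  rw [lt_div_iff₀ (by positivity)]
  linarith

theorem measurable_jumpTime (ω : ℝ) (n : ℕ) : Measurable (fun w : Noise => jumpTime ω w n) := by
  unfold jumpTime
  exact Finset.measurable_sum _ fun i _ => ((measurable_pi_apply i).fst).div_const _

theorem measurable_numJumps (ω t : ℝ) : Measurable (fun w : Noise => numJumps ω w t) := by
  have hlt : ∀ n, MeasurableSet {w : Noise | t < jumpTime ω w (n + 1)} := fun n =>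
    measurableSet_lt measurable_const (measurable_jumpTime ω (n + 1))
  refine measurable_of_Ioi fun k => ?_
  -- The union on the right excludes the empty set of indices, for which `sInf` defaults to `0`.
  have : (fun w : Noise => numJumps ω w t) ⁻¹' Set.Ioi k
      = (⋂ n, ⋂ _ : n ≤ k, {w | t < jumpTime ω w (n + 1)}ᶜ) ∩
        ⋃ n, {w | t < jumpTime ω w (n + 1)} := by
    ext w
    simp only [Set.mem_preimage, Set.mem_Ioi, Set.mem_inter_iff, Set.mem_iInter, Set.mem_iUnion,
      Set.mem_compl_iff, Set.mem_ofPred_eq]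
    refine ⟨fun hk => ⟨fun n hn hn' => ?_, Nat.nonempty_of_pos_sInf
      (lt_of_le_of_lt (Nat.zero_le _) hk)⟩, ?_⟩
    · exact absurd (Nat.sInf_le (show n ∈ {n : ℕ | t < jumpTime ω w (n + 1)} from hn'))
        (not_le.2 (lt_of_le_of_lt hn hk))
    · rintro ⟨h1, h2⟩
      by_contra hk
      exact h1 _ (not_lt.1 hk) (Nat.sInf_mem h2)
  rw [this]
  exact (MeasurableSet.iInter fun n => MeasurableSet.iInter fun _ => (hlt n).compl).inter
    (MeasurableSet.iUnion hlt)

theorem measurable_process_noise (ω μ v t : ℝ) (z : State) :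
    Measurable (fun w : Noise => process ω μ v z w t) :=
  (measurable_process ω μ v t).comp (measurable_const.prodMk measurable_id)

theorem measurable_velocity (ω t : ℝ) (σ : Vel) :
    Measurable (fun w : Noise => velocity ω σ w t) :=
  (measurable_process_noise ω 0 0 t (0, σ)).snd

/-! ### The semigroup property -/

/-- The expectation of `f` at time `t`, for the process started from `z`. -/
noncomputable def transition (ω μ v t : ℝ) (f : State → ℝ≥0∞) (z : State) : ℝ≥0∞ :=
  ∫⁻ w, f (process ω μ v z w t) ∂noiseLaw

theorem measurable_transition (ω μ v t : ℝ) {f : State → ℝ≥0∞} (hf : Measurable f) :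
    Measurable (transition ω μ v t f) :=
  (hf.comp (measurable_process ω μ v t)).lintegral_prod_right'

theorem lintegral_evolve (ω μ v : ℝ) (η : Measure State) [SFinite η] (t : ℝ) {f : State → ℝ≥0∞}
    (hf : Measurable f) : ∫⁻ z, f z ∂(evolve ω μ v η t) = ∫⁻ z, transition ω μ v t f z ∂η := by
  rw [evolve, lintegral_map hf (measurable_process ω μ v t)]
  exact lintegral_prod _ (hf.comp (measurable_process ω μ v t)).aemeasurable

/-- The Markov property at time `s` on the event of exactly `n` jumps before `s`. Without a jump it
is the lack of memory of the first clock; otherwise the path is restarted at its first jump, which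
lowers `n`. -/
theorem lintegral_numJumps_eq_process_add {ω μ : ℝ} (hω : 0 < ω) (hμ : 0 < μ) (v : ℝ) {t : ℝ} (ht : 0 ≤ t)
    {f : State → ℝ≥0∞} (hf : Measurable f) (n : ℕ) :
    ∀ (s : ℝ) (_ : 0 ≤ s) (z : State),
      ∫⁻ w, {w | numJumps ω w s = n}.indicator (fun w => f (process ω μ v z w (s + t))) w ∂noiseLaw
      = ∫⁻ w, {w | numJumps ω w s = n}.indicator
          (fun w => transition ω μ v t f (process ω μ v z w s)) w ∂noiseLaw := by
  have hset : ∀ (s : ℝ) (n : ℕ), MeasurableSet {w : Noise | numJumps ω w s = n} := fun s n =>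
    measurable_numJumps ω s (measurableSet_singleton n)
  have hm1 : ∀ (s : ℝ) (n : ℕ) (z : State), Measurable ({w : Noise | numJumps ω w s = n}.indicator
      (fun w => f (process ω μ v z w (s + t)))) := fun s n z =>
    (hf.comp (measurable_process_noise ω μ v (s + t) z)).indicator (hset s n)
  have hm2 : ∀ (s : ℝ) (n : ℕ) (z : State), Measurable ({w : Noise | numJumps ω w s = n}.indicator
      (fun w => transition ω μ v t f (process ω μ v z w s))) := fun s n z =>
    ((measurable_transition ω μ v t hf).comp (measurable_process_noise ω μ v s z)).indicator
      (hset s n)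
  induction n with
  | zero =>
    intro s hs z
    rw [lintegral_noiseLaw (hm1 s 0 z), lintegral_noiseLaw (hm2 s 0 z)]
    have hiff : ∀ ξ : ℝ, s < ξ / (2 * ω) ↔ 2 * ω * s < ξ := fun ξ => by
      rw [lt_div_iff₀ (by positivity), mul_comm]
    have hno : ∀ a : ℝ × Bool, ¬ 2 * ω * s < a.1 →
        ∀ᵐ w ∂noiseLaw, numJumps ω (consNoise a w) s ≠ 0 := fun a h => by
      filter_upwards [ae_nonExploding hω] with w hw
      rw [numJumps_of_le (not_lt.1 ((hiff _).not.2 h)) hw]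
      exact Nat.succ_ne_zero _
    set z' : State := (jammedFlow μ v z.2 s z.1, z.2) with hz'
    have hH : Measurable fun a : ℝ × Bool =>
        ∫⁻ w, f (process ω μ v z' (consNoise a w) t) ∂noiseLaw :=
      ((hf.comp (measurable_process_noise ω μ v t z')).comp
        measurable_consNoise).lintegral_prod_right'
    -- Both sides equal the probability `exp (-2 * ω * s)` of no jump times the same expectation
    -- from `z'`: on the left the residual clock is again exponential, on the right the integrand is
    -- constant.
    have h1 := lintegral_clock_residual hH (a := 2 * ω * s) (by positivity)
    have h2 := lintegral_clock_residual (H := fun _ => transition ω μ v t f z')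
      measurable_const (a := 2 * ω * s) (by positivity)
    have h3 : ∫⁻ a, ∫⁻ w, f (process ω μ v z' (consNoise a w) t) ∂noiseLaw
        ∂((expMeasure 1).prod coin) = transition ω μ v t f z' :=
      (lintegral_noiseLaw (hf.comp (measurable_process_noise ω μ v t z'))).symm
    rw [h3] at h1
    rw [lintegral_const, measure_univ, mul_one] at h2
    refine Eq.trans (lintegral_congr fun a => ?_)
      ((h1.trans h2.symm).trans (lintegral_congr fun a => ?_))
    · by_cases h : 2 * ω * s < a.1
      · rw [Set.indicator_of_mem (by exact h)]
        refine lintegral_congr_ae ?_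
        filter_upwards [ae_nonExploding hω] with w hw
        rw [Set.indicator_of_mem (by exact numJumps_of_lt ((hiff _).2 h)),
          process_add_of_lt hω hμ v hs ht ((hiff _).2 h) hw]
      · rw [Set.indicator_of_notMem (by exact h)]
        refine (lintegral_congr_ae ?_).trans lintegral_zero
        filter_upwards [hno a h] with w hw
        rw [Set.indicator_of_notMem (by exact hw)]
    · by_cases h : 2 * ω * s < a.1
      · rw [Set.indicator_of_mem (by exact h)]
        refine Eq.trans ?_ (lintegral_congr fun w => ?_) (b := ∫⁻ _, transition ω μ v t f z' ∂noiseLaw)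
        · simp
        rw [Set.indicator_of_mem (by exact numJumps_of_lt ((hiff _).2 h)),
          process_of_lt ((hiff _).2 h)]
      · rw [Set.indicator_of_notMem (by exact h)]
        refine ((lintegral_congr_ae ?_).trans lintegral_zero).symm
        filter_upwards [hno a h] with w hw
        rw [Set.indicator_of_notMem (by exact hw)]
  | succ n ih =>
    intro s hs z
    rw [lintegral_noiseLaw (hm1 s _ z), lintegral_noiseLaw (hm2 s _ z)]
    refine lintegral_congr fun a => ?_
    rcases lt_or_ge s (a.1 / (2 * ω)) with h | h
    · simp [numJumps_of_lt h]
    · have h2 := ih (s - a.1 / (2 * ω)) (by linarith) (firstJump ω μ v z a)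
      refine Eq.trans (lintegral_congr_ae ?_) (h2.trans (lintegral_congr_ae ?_))
      · filter_upwards [ae_nonExploding hω] with w hw
        simp only [Set.indicator_apply, Set.mem_ofPred_eq, numJumps_of_le h hw,
          Nat.succ_inj]
        rw [process_of_le (by linarith) hw]
        ring_nf
      · filter_upwards [ae_nonExploding hω] with w hw
        simp only [Set.indicator_apply, Set.mem_ofPred_eq, numJumps_of_le h hw,
          Nat.succ_inj]
        rw [process_of_le h hw]

theorem lintegral_eq_tsum_numJumps (ω s : ℝ) {g : Noise → ℝ≥0∞} (hg : Measurable g) :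
    ∫⁻ w, g w ∂noiseLaw
      = ∑' n, ∫⁻ w, {w | numJumps ω w s = n}.indicator g w ∂noiseLaw := by
  have hm : ∀ n, Measurable ({w | numJumps ω w s = n}.indicator g) := fun n =>
    hg.indicator (measurable_numJumps ω s (measurableSet_singleton n))
  rw [← lintegral_tsum fun n => (hm n).aemeasurable]
  refine lintegral_congr fun w => ?_
  rw [tsum_eq_single (numJumps ω w s) fun n hn => Set.indicator_of_notMem (by exact hn.symm) _,
    Set.indicator_of_mem (by rfl)]

/-- The Chapman–Kolmogorov equation. -/
theorem transition_add {ω μ : ℝ} (hω : 0 < ω) (hμ : 0 < μ) (v : ℝ) {s t : ℝ} (hs : 0 ≤ s)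
    (ht : 0 ≤ t) {f : State → ℝ≥0∞} (hf : Measurable f) (z : State) :
    transition ω μ v (s + t) f z = transition ω μ v s (transition ω μ v t f) z := by
  refine (lintegral_eq_tsum_numJumps ω s
    (hf.comp (measurable_process_noise ω μ v (s + t) z))).trans (Eq.trans ?_
    (lintegral_eq_tsum_numJumps ω s
      ((measurable_transition ω μ v t hf).comp (measurable_process_noise ω μ v s z))).symm)
  exact tsum_congr fun n => lintegral_numJumps_eq_process_add hω hμ v ht hf n s hs z

theorem evolve_evolve {ω μ : ℝ} (hω : 0 < ω) (hμ : 0 < μ) (v : ℝ) (η : Measure State)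
    [IsProbabilityMeasure η] {s t : ℝ} (hs : 0 ≤ s) (ht : 0 ≤ t) :
    evolve ω μ v (evolve ω μ v η s) t = evolve ω μ v η (s + t) := by
  refine Measure.ext_of_lintegral _ fun f hf => ?_
  rw [lintegral_evolve _ _ _ _ _ hf, lintegral_evolve _ _ _ _ _ hf,
    lintegral_evolve _ _ _ _ _ (measurable_transition ω μ v t hf)]
  exact lintegral_congr fun z => (transition_add hω hμ v hs ht hf z).symm

/-! ### Maximal couplings of finitely valued random variables -/

/-- The common mass `min (p i) (q i)` goes on the diagonal, and the residual masses, both of total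
`δ`, are coupled independently. -/
theorem exists_coupling_matrix {α : Type*} [Fintype α] [DecidableEq α] {p q : α → ℝ}
    (hp : ∀ i, 0 ≤ p i) (hq : ∀ i, 0 ≤ q i) (hp1 : ∑ i, p i = 1) (hq1 : ∑ i, q i = 1) :
    ∃ κ : α → α → ℝ, (∀ i j, 0 ≤ κ i j) ∧ (∀ i, ∑ j, κ i j = p i) ∧ (∀ j, ∑ i, κ i j = q j) ∧
      ∑ i, min (p i) (q i) ≤ ∑ i, κ i i := by
  set m : α → ℝ := fun i => min (p i) (q i) with hm
  set δ : ℝ := 1 - ∑ i, m i with hδ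
  have hpm : ∀ i, 0 ≤ p i - m i := fun i => sub_nonneg.2 (min_le_left _ _)
  have hqm : ∀ i, 0 ≤ q i - m i := fun i => sub_nonneg.2 (min_le_right _ _)
  have hsp : ∑ i, (p i - m i) = δ := by rw [Finset.sum_sub_distrib, hp1]
  have hsq : ∑ i, (q i - m i) = δ := by rw [Finset.sum_sub_distrib, hq1]
  have hδ0 : 0 ≤ δ := hsp ▸ Finset.sum_nonneg fun i _ => hpm i
  -- When `δ = 0` the division returns `0`, which is right because the residuals vanish.
  have hz : ∀ r : α → ℝ, (∀ i, 0 ≤ r i) → ∑ i, r i = δ → ∀ i, r i * δ / δ = r i := by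
    intro r hr hs i
    rcases eq_or_ne δ 0 with h | h
    · rw [h] at hs ⊢
      simp [(Finset.sum_eq_zero_iff_of_nonneg fun i _ => hr i).1 hs i (Finset.mem_univ i)]
    · field_simp
  refine ⟨fun i j => (if i = j then m i else 0) + (p i - m i) * (q j - m j) / δ,
    fun i j => ?_, fun i => ?_, fun j => ?_, ?_⟩
  · refine add_nonneg ?_ (div_nonneg (mul_nonneg (hpm i) (hqm j)) hδ0)
    split_ifs; exacts [le_min (hp i) (hq i), le_rfl]
  · rw [Finset.sum_add_distrib, ← Finset.sum_div, ← Finset.mul_sum, hsq, hz _ hpm hsp]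
    simp
  · rw [Finset.sum_add_distrib, ← Finset.sum_div, ← Finset.sum_mul, hsp, mul_comm,
      hz _ hqm hsq]
    simp
  · refine Finset.sum_le_sum fun i _ => ?_
    simp only [if_true]
    have := div_nonneg (mul_nonneg (hpm i) (hqm i)) hδ0
    linarith

/-- A pair of values `(i, j)` is drawn from the coupling matrix, then the two outcomes are drawn
independently from `P` conditioned on `X = i` and on `Y = j`. Averaging the conditional laws
restores `P`, so the whole noise is coupled, not only the values of `X` and `Y`. -/
theorem exists_maximal_coupling {Ω α : Type*} [MeasurableSpace Ω] [Fintype α] [DecidableEq α]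
    [MeasurableSpace α] [MeasurableSingletonClass α] (P : Measure Ω) [IsProbabilityMeasure P]
    {X Y : Ω → α} (hX : Measurable X) (hY : Measurable Y) :
    ∃ Γ : Measure (Ω × Ω), Γ.map Prod.fst = P ∧ Γ.map Prod.snd = P ∧
      Γ {w | X w.1 ≠ Y w.2}
        ≤ ENNReal.ofReal (1 - ∑ i, min (P.real (X ⁻¹' {i})) (P.real (Y ⁻¹' {i}))) := by
  have hsum : ∀ {Z : Ω → α}, Measurable Z → ∑ i, P.real (Z ⁻¹' {i}) = 1 := by
    intro Z hZ
    rw [sum_measureReal_preimage_singleton _ fun i _ => hZ (measurableSet_singleton i)]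
    simp
  obtain ⟨κ, h0, h1, h2, h3⟩ := exists_coupling_matrix (p := fun i => P.real (X ⁻¹' {i}))
    (q := fun i => P.real (Y ⁻¹' {i})) (fun _ => measureReal_nonneg) (fun _ => measureReal_nonneg)
    (hsum hX) (hsum hY)
  -- Conditioning on a null event does not give a probability, but then the weight `κ i j` is zero.
  have hκX : ∀ i j, ENNReal.ofReal (κ i j) * (P[|X ← i]) Set.univ = ENNReal.ofReal (κ i j) := by
    intro i j
    by_cases h : P (X ⁻¹' {i}) = 0
    · have : κ i j ≤ 0 := by
        refine (Finset.single_le_sum (fun j _ => h0 i j) (Finset.mem_univ j)).trans ?_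
        rw [h1]; simp [measureReal_def, h]
      rw [ENNReal.ofReal_of_nonpos this, zero_mul]
    · have := cond_isProbabilityMeasure (μ := P) h
      rw [measure_univ, mul_one]
  have hκY : ∀ i j, ENNReal.ofReal (κ i j) * (P[|Y ← j]) Set.univ = ENNReal.ofReal (κ i j) := by
    intro i j
    by_cases h : P (Y ⁻¹' {j}) = 0
    · have : κ i j ≤ 0 := by
        refine (Finset.single_le_sum (f := fun i => κ i j) (fun i _ => h0 i j)
          (Finset.mem_univ i)).trans ?_
        rw [h2]; simp [measureReal_def, h]
      rw [ENNReal.ofReal_of_nonpos this, zero_mul]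
    · have := cond_isProbabilityMeasure (μ := P) h
      rw [measure_univ, mul_one]
  refine ⟨∑ i, ∑ j, ENNReal.ofReal (κ i j) • (P[|X ← i]).prod (P[|Y ← j]), ?_, ?_, ?_⟩
  · conv_rhs => rw [← sum_meas_smul_cond_fiber hX P]
    rw [Measure.map_finset_sum measurable_fst.aemeasurable]
    refine Finset.sum_congr rfl fun i _ => ?_
    rw [Measure.map_finset_sum measurable_fst.aemeasurable]
    simp_rw [Measure.map_smul, Measure.map_fst_prod, smul_smul, hκY]
    rw [← Finset.sum_smul, ← ENNReal.ofReal_sum_of_nonneg fun j _ => h0 i j, h1, ofReal_measureReal]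
  · conv_rhs => rw [← sum_meas_smul_cond_fiber hY P]
    rw [Finset.sum_comm, Measure.map_finset_sum measurable_snd.aemeasurable]
    refine Finset.sum_congr rfl fun j _ => ?_
    rw [Measure.map_finset_sum measurable_snd.aemeasurable]
    simp_rw [Measure.map_smul, Measure.map_snd_prod, smul_smul, hκX]
    rw [← Finset.sum_smul, ← ENNReal.ofReal_sum_of_nonneg fun i _ => h0 i j, h2, ofReal_measureReal]
  · have hle : ∀ i j, ((P[|X ← i]).prod (P[|Y ← j])) {w | X w.1 ≠ Y w.2}
        ≤ if i = j then 0 else 1 := by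
      intro i j
      split_ifs with hij
      · subst hij
        have hx : ∀ᵐ w ∂((P[|X ← i]).prod (P[|Y ← i])), X w.1 = i :=
          Measure.quasiMeasurePreserving_fst.ae (ae_cond_mem (hX (measurableSet_singleton i)))
        have hy : ∀ᵐ w ∂((P[|X ← i]).prod (P[|Y ← i])), Y w.2 = i :=
          Measure.quasiMeasurePreserving_snd.ae (ae_cond_mem (hY (measurableSet_singleton i)))
        refine le_of_eq (ae_iff.1 ?_)
        filter_upwards [hx, hy] with w h h'
        rw [h, h']
      · refine (measure_mono (Set.subset_univ _)).trans ?_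
        rw [← Set.univ_prod_univ, Measure.prod_prod]
        exact mul_le_one' prob_le_one prob_le_one
    have htot : ∑ i, ∑ j, κ i j = 1 := by simp_rw [h1]; exact hsum hX
    simp only [Measure.coe_finsetSum, Finset.sum_apply, Measure.smul_apply, smul_eq_mul]
    calc _ ≤ ∑ i, ∑ j, ENNReal.ofReal (κ i j) * (if i = j then 0 else 1) :=
          Finset.sum_le_sum fun i _ => Finset.sum_le_sum fun j _ => by gcongr; exact hle i j
      _ = ENNReal.ofReal (∑ i, ∑ j, κ i j * (if i = j then 0 else 1)) := by
          have hnn : ∀ i j, 0 ≤ κ i j * (if i = j then (0 : ℝ) else 1) := fun i j =>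
            mul_nonneg (h0 i j) (by split_ifs <;> norm_num)
          rw [ENNReal.ofReal_sum_of_nonneg fun i _ => Finset.sum_nonneg fun j _ => hnn i j]
          refine Finset.sum_congr rfl fun i _ => ?_
          rw [ENNReal.ofReal_sum_of_nonneg fun j _ => hnn i j]
          refine Finset.sum_congr rfl fun j _ => ?_
          split_ifs <;> simp
      _ ≤ _ := by
          refine ENNReal.ofReal_le_ofReal ?_
          have : ∑ i, ∑ j, κ i j * (if i = j then (0 : ℝ) else 1)
              = ∑ i, ∑ j, κ i j - ∑ i, κ i i := by
            rw [← Finset.sum_sub_distrib]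
            refine Finset.sum_congr rfl fun i _ => ?_
            have : ∀ j, κ i j * (if i = j then (0 : ℝ) else 1)
                = κ i j - if i = j then κ i j else 0 := fun j => by split_ifs <;> ring
            simp_rw [this, Finset.sum_sub_distrib]
            simp
          rw [this, htot]
          linarith

/-! ### The law of the velocity -/

/-- The transition probabilities of the velocity. -/
noncomputable def velocityProb (ω t : ℝ) (σ b : Vel) : ℝ :=
  noiseLaw.real ((fun w => velocity ω σ w t) ⁻¹' {b})

theorem velocity_of_lt {ω t : ℝ} {σ : Vel} {a : ℝ × Bool} {w : Noise} (h : t < a.1 / (2 * ω)) :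
    velocity ω σ (consNoise a w) t = σ := by
  simp [velocity, process_of_lt h]

theorem velocity_of_le {ω t : ℝ} {σ : Vel} {a : ℝ × Bool} {w : Noise} (h : a.1 / (2 * ω) ≤ t)
    (hw : NonExploding ω w) :
    velocity ω σ (consNoise a w) t
      = velocity ω (jumpTarget σ a.2) w (t - a.1 / (2 * ω)) := by
  rw [velocity, process_of_le h hw, process_snd, firstJump]

/-- Renewal equation at the first jump; it replaces solving the Kolmogorov equations. -/
theorem measure_velocity_eq {ω : ℝ} (hω : 0 < ω) (t : ℝ) (σ b : Vel) :
    noiseLaw ((fun w => velocity ω σ w t) ⁻¹' {b})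
      = ∫⁻ a, (if t < a.1 / (2 * ω) then (if σ = b then 1 else 0)
          else noiseLaw ((fun w => velocity ω (jumpTarget σ a.2) w (t - a.1 / (2 * ω))) ⁻¹' {b}))
        ∂((expMeasure 1).prod coin) := by
  have hms : ∀ s σ, MeasurableSet ((fun w => velocity ω σ w s) ⁻¹' {b}) := fun s σ =>
    measurable_velocity ω s σ (measurableSet_singleton b)
  rw [← lintegral_indicator_one (hms t σ),
    lintegral_noiseLaw (measurable_one.indicator (hms t σ))]
  refine lintegral_congr fun a => ?_
  split_ifs with h h1
  · simp [velocity_of_lt h, h1]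
  · simp [velocity_of_lt h, h1]
  · rw [← lintegral_indicator_one (hms _ _)]
    refine lintegral_congr_ae ?_
    filter_upwards [ae_nonExploding hω] with w hw
    by_cases hb : velocity ω (jumpTarget σ a.2) w (t - a.1 / (2 * ω)) = b <;>
      simp [velocity_of_le (not_lt.1 h) hw, hb]

theorem measure_lt_clock {ω : ℝ} (hω : 0 < ω) {t : ℝ} (ht : 0 ≤ t) :
    ((expMeasure 1).prod coin) {a | t < a.1 / (2 * ω)} = ENNReal.ofReal (Real.exp (-2 * ω * t)) := by
  have : {a : ℝ × Bool | t < a.1 / (2 * ω)} = Set.Ioi (2 * ω * t) ×ˢ Set.univ := by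
    ext a
    simp only [Set.mem_ofPred_eq, Set.mem_prod, Set.mem_Ioi, Set.mem_univ, and_true]
    rw [lt_div_iff₀ (by positivity), mul_comm]
  rw [this, Measure.prod_prod, measure_univ, mul_one, expMeasure_Ioi _ (by positivity)]
  ring_nf

theorem measurableSet_lt_clock (ω t : ℝ) :
    MeasurableSet {a : ℝ × Bool | t < a.1 / (2 * ω)} :=
  measurableSet_lt measurable_const (measurable_fst.div_const _)

/-- Reflection of velocities. -/
def Vel.flip : Vel → Vel
  | .minus => .plus
  | .zero => .zero
  | .plus => .minus

theorem jumpTarget_flip (σ : Vel) (b : Bool) : jumpTarget σ.flip (!b) = (jumpTarget σ b).flip := by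
  cases σ <;> cases b <;> rfl

/-- Reflection of all coins. -/
def flipNoise (w : Noise) : Noise := fun i => ((w i).1, !(w i).2)

theorem measurePreserving_flipNoise : MeasurePreserving flipNoise noiseLaw noiseLaw := by
  have hcoin : coin.map (fun b => !b) = coin := by
    refine Measure.ext_of_singleton fun b => ?_
    have h : ∀ b : Bool, coin {b} = 2⁻¹ := fun b => by
      rw [coin, PMF.toMeasure_apply_singleton _ _ (measurableSet_singleton b)]; simp
    have hb : (fun b : Bool => !b) ⁻¹' {b} = {!b} := by ext c; cases b <;> cases c <;> simp
    rw [Measure.map_apply (measurable_of_countable _) (measurableSet_singleton b), hb, h, h]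
  have hf : Measurable (fun a : ℝ × Bool => (a.1, !a.2)) :=
    measurable_fst.prodMk ((measurable_of_countable (fun b : Bool => !b)).comp measurable_snd)
  have hmap : ((expMeasure 1).prod coin).map (fun a : ℝ × Bool => (a.1, !a.2))
      = (expMeasure 1).prod coin := by
    have := Measure.map_prod_map (expMeasure 1) coin measurable_id
      (measurable_of_countable (fun b : Bool => !b))
    rw [Measure.map_id, hcoin] at this
    exact this.symm
  refine ⟨measurable_pi_iff.2 fun i => hf.comp (measurable_pi_apply i), ?_⟩
  have := Measure.infinitePi_map_pi (fun _ : ℕ => (expMeasure 1).prod coin) (fun _ => hf)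
  simp only [hmap] at this
  exact this

theorem velocity_flip (ω t : ℝ) (σ : Vel) (w : Noise) :
    velocity ω σ.flip (flipNoise w) t = (velocity ω σ w t).flip := by
  have h : ∀ n, (skeleton ω 0 0 (0, σ.flip) (flipNoise w) n).2.2
      = (skeleton ω 0 0 (0, σ) w n).2.2.flip := by
    intro n
    induction n with
    | zero => rfl
    | succ n ih =>
      simp only [skeleton, ih]
      exact jumpTarget_flip _ _
  simp only [velocity, process_eq, h]
  rfl

theorem velocityProb_flip (ω t : ℝ) (σ b : Vel) :
    velocityProb ω t σ.flip b.flip = velocityProb ω t σ b := by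
  have hm := measurable_velocity ω t σ.flip (measurableSet_singleton b.flip)
  rw [velocityProb, velocityProb, measureReal_def, measureReal_def,
    ← measurePreserving_flipNoise.measure_preimage hm.nullMeasurableSet]
  congr 2
  ext w
  simp only [Set.mem_preimage, velocity_flip, Set.mem_singleton_iff]
  have hinj : Function.Injective Vel.flip := fun a b => by cases a <;> cases b <;> simp [Vel.flip]
  exact hinj.eq_iff

/-- Parity: every jump exchanges zero and nonzero velocities, and under a common noise both paths
have jumped equally often. -/
theorem velocity_eq_zero_iff (ω t : ℝ) {σ : Vel} (hσ : σ ≠ .zero) (w : Noise) :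
    velocity ω σ w t = .zero ↔ velocity ω .zero w t ≠ .zero := by
  have hj : ∀ (τ : Vel) (b : Bool), jumpTarget τ b = .zero ↔ τ ≠ .zero := fun τ b => by
    cases τ <;> cases b <;> simp [jumpTarget]
  have h : ∀ n, (skeleton ω 0 0 (0, σ) w n).2.2 = .zero
      ↔ (skeleton ω 0 0 (0, .zero) w n).2.2 ≠ .zero := by
    intro n
    induction n with
    | zero => simpa [skeleton] using hσ
    | succ n ih => simp only [skeleton, hj, ne_eq, ih]
  simp only [velocity, process_eq]
  exact h _

theorem velocityProb_sum (ω t : ℝ) (σ : Vel) :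
    velocityProb ω t σ .minus + velocityProb ω t σ .zero + velocityProb ω t σ .plus = 1 := by
  have := sum_measureReal_preimage_singleton (μ := noiseLaw) (f := fun w => velocity ω σ w t)
    Finset.univ fun i _ => measurable_velocity ω t σ (measurableSet_singleton i)
  have hu : (Finset.univ : Finset Vel) = {.minus, .zero, .plus} := rfl
  rw [Finset.coe_univ, Set.preimage_univ, probReal_univ, hu, Finset.sum_insert (by decide),
    Finset.sum_insert (by decide), Finset.sum_singleton] at this
  rw [← this, add_assoc]
  rfl

theorem velocityProb_zero_of_ne (ω t : ℝ) {σ : Vel} (hσ : σ ≠ .zero) :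
    velocityProb ω t σ .zero = 1 - velocityProb ω t .zero .zero := by
  have hm := measurable_velocity ω t .zero (measurableSet_singleton .zero)
  rw [velocityProb, velocityProb, ← probReal_compl_eq_one_sub hm]
  congr 1
  ext w
  exact velocity_eq_zero_iff ω t hσ w

theorem ofReal_velocityProb (ω t : ℝ) (σ b : Vel) :
    ENNReal.ofReal (velocityProb ω t σ b) = noiseLaw ((fun w => velocity ω σ w t) ⁻¹' {b}) :=
  ofReal_measureReal

theorem velocityProb_nonneg (ω t : ℝ) (σ b : Vel) : 0 ≤ velocityProb ω t σ b :=
  measureReal_nonneg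

/-- After a first jump the velocity is zero, and from there `plus` and `minus` are equally likely by
reflection. Only the event of no jump distinguishes the two. -/
theorem velocityProb_plus_plus {ω : ℝ} (hω : 0 < ω) {t : ℝ} (ht : 0 ≤ t) :
    velocityProb ω t .plus .plus = Real.exp (-2 * ω * t) + velocityProb ω t .plus .minus := by
  have hE := (Real.exp_pos (-2 * ω * t)).le
  have h0 : ∀ s, noiseLaw ((fun w => velocity ω .zero w s) ⁻¹' {.plus})
      = noiseLaw ((fun w => velocity ω .zero w s) ⁻¹' {.minus}) := fun s => by
    rw [← ofReal_velocityProb, ← ofReal_velocityProb, ← velocityProb_flip]; rfl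
  rw [← ENNReal.ofReal_eq_ofReal_iff (velocityProb_nonneg ..)
    (add_nonneg hE (velocityProb_nonneg ..)), ENNReal.ofReal_add hE (velocityProb_nonneg ..),
    ofReal_velocityProb, ofReal_velocityProb, measure_velocity_eq hω, measure_velocity_eq hω,
    ← measure_lt_clock hω ht, ← lintegral_indicator_one (measurableSet_lt_clock ω t),
    ← lintegral_add_left (measurable_one.indicator (measurableSet_lt_clock ω t))]
  refine lintegral_congr fun a => ?_
  by_cases h : t < a.1 / (2 * ω)
  · simp [h]
  · simp [h, jumpTarget, h0]

/-- With `A` the return probability at time `t / 2`, the semigroup property and parity give `A ^ 2 +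
(1 - A) ^ 2` at time `t`, which is at least `1 / 2`. -/
theorem half_le_velocityProb {ω : ℝ} (hω : 0 < ω) {t : ℝ} (ht : 0 ≤ t) :
    1 / 2 ≤ velocityProb ω t .zero .zero := by
  set S : Set State := {z | z.2 = .zero}
  have hS : MeasurableSet S := measurable_snd (measurableSet_singleton Vel.zero)
  -- The parameters `μ = 1` and `v = 0` are placeholders, as the velocity does not depend on them.
  have htr : ∀ s z, transition ω 1 0 s (S.indicator 1) z
      = ENNReal.ofReal (velocityProb ω s z.2 .zero) := fun s z => by
    rw [ofReal_velocityProb, ← lintegral_indicator_one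
      (measurable_velocity ω s z.2 (measurableSet_singleton _))]
    refine lintegral_congr fun w => ?_
    by_cases h : velocity ω z.2 w s = .zero <;> simp [S, process_snd, h]
  set A := velocityProb ω (t / 2) .zero .zero with hA
  have hA0 : 0 ≤ A := measureReal_nonneg
  have hA1 : A ≤ 1 := measureReal_le_one
  have hm := measurable_velocity ω (t / 2) .zero (measurableSet_singleton .zero)
  have hck := transition_add hω one_pos 0 (s := t / 2) (t := t / 2) (by linarith) (by linarith)
    (measurable_one.indicator hS) (0, .zero)
  rw [add_halves, htr] at hck
  have h2 : transition ω 1 0 (t / 2) (transition ω 1 0 (t / 2) (S.indicator 1)) (0, .zero)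
      = ENNReal.ofReal (A * A + (1 - A) * (1 - A)) := by
    have : ∀ w, transition ω 1 0 (t / 2) (S.indicator 1) (process ω 1 0 (0, .zero) w (t / 2))
        = ((fun w => velocity ω .zero w (t / 2)) ⁻¹' {.zero}).indicator
            (fun _ => ENNReal.ofReal A) w
          + ((fun w => velocity ω .zero w (t / 2)) ⁻¹' {.zero})ᶜ.indicator
            (fun _ => ENNReal.ofReal (1 - A)) w := by
      intro w
      rw [htr, process_snd]
      by_cases h : velocity ω .zero w (t / 2) = .zero
      · simp [h, hA]
      · simp [h, velocityProb_zero_of_ne ω (t / 2) h, hA]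
    conv_lhs => rw [transition]
    rw [lintegral_congr this, lintegral_add_left (measurable_const.indicator hm),
      lintegral_indicator_const hm, lintegral_indicator_const hm.compl,
      prob_compl_eq_one_sub hm, ← ofReal_velocityProb, ← hA, ← ENNReal.ofReal_one,
      ← ENNReal.ofReal_sub _ hA0, ← ENNReal.ofReal_mul hA0, ← ENNReal.ofReal_mul (by linarith),
      ← ENNReal.ofReal_add (by positivity) (mul_self_nonneg _)]
  rw [h2, ENNReal.ofReal_eq_ofReal_iff (velocityProb_nonneg ..)
    (add_nonneg (mul_self_nonneg _) (mul_self_nonneg _))] at hck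
  rw [hck]
  nlinarith [sq_nonneg (2 * A - 1)]

/-- After a first jump the velocity is nonzero, and from there the probability of being at zero is
at most `1 / 2` by parity and the previous bound. -/
theorem velocityProb_zero_le {ω : ℝ} (hω : 0 < ω) {t : ℝ} (ht : 0 ≤ t) :
    velocityProb ω t .zero .zero ≤ (1 + Real.exp (-2 * ω * t)) / 2 := by
  have hms := measurableSet_lt_clock ω t
  have hE1 : Real.exp (-2 * ω * t) ≤ 1 := by
    rw [Real.exp_le_one_iff]; nlinarith [mul_nonneg hω.le ht]
  rw [← ENNReal.ofReal_le_ofReal_iff (by positivity), ofReal_velocityProb, measure_velocity_eq hω]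
  calc _ ≤ ∫⁻ a, ({a : ℝ × Bool | t < a.1 / (2 * ω)}.indicator 1 a
        + {a : ℝ × Bool | t < a.1 / (2 * ω)}ᶜ.indicator (fun _ => ENNReal.ofReal (1 / 2)) a)
          ∂((expMeasure 1).prod coin) := by
        refine lintegral_mono fun a => ?_
        by_cases h : t < a.1 / (2 * ω)
        · simp [h]
        · have hne : jumpTarget .zero a.2 ≠ .zero := by cases a.2 <;> simp [jumpTarget]
          have := half_le_velocityProb hω (t := t - a.1 / (2 * ω)) (by linarith)
          simp only [h, if_false, Set.indicator_apply, Set.mem_ofPred_eq, Set.mem_compl_iff,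
            not_false_eq_true, if_true, zero_add]
          rw [← ofReal_velocityProb, velocityProb_zero_of_ne _ _ hne]
          exact ENNReal.ofReal_le_ofReal (by linarith)
    _ = _ := by
        rw [lintegral_add_left (measurable_one.indicator hms), lintegral_indicator_one hms,
          lintegral_indicator_const hms.compl, prob_compl_eq_one_sub hms, measure_lt_clock hω ht,
          ← ENNReal.ofReal_one, ← ENNReal.ofReal_sub _ (Real.exp_pos _).le,
          ← ENNReal.ofReal_mul (by norm_num),
          ← ENNReal.ofReal_add (Real.exp_pos _).le (by linarith)]
        congr 1; ring

/-- Let `a` be the return probability to zero and `E` the exponential. Between `plus` and `minus`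
the defect is exactly `E`. Between zero and a nonzero velocity, the bounds `1 / 2 ≤ a ≤ (1 + E) / 2`
decide each minimum and the defect is `a - (1 - E) / 2 ≤ E`. -/
theorem velocityProb_overlap {ω : ℝ} (hω : 0 < ω) {t : ℝ} (ht : 0 ≤ t) {σ σ' : Vel} (h : σ ≠ σ') :
    1 - ∑ b, min (velocityProb ω t σ b) (velocityProb ω t σ' b) ≤ Real.exp (-2 * ω * t) := by
  have hu : (Finset.univ : Finset Vel) = {.minus, .zero, .plus} := rfl
  rw [hu, Finset.sum_insert (by decide), Finset.sum_insert (by decide), Finset.sum_singleton]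
  have hE := Real.exp_pos (-2 * ω * t)
  have h1 := half_le_velocityProb hω ht
  have h2 := velocityProb_zero_le hω ht
  have h3 := velocityProb_plus_plus hω ht
  have h4 := velocityProb_sum ω t .zero
  have h5 := velocityProb_sum ω t .plus
  have h6 := velocityProb_zero_of_ne ω t (σ := .plus) (by decide)
  have h7 := velocityProb_zero_of_ne ω t (σ := .minus) (by decide)
  have h8 : velocityProb ω t .minus .plus = velocityProb ω t .plus .minus :=
    velocityProb_flip ω t .plus .minus
  have h9 : velocityProb ω t .minus .minus = velocityProb ω t .plus .plus :=
    velocityProb_flip ω t .plus .plus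
  have h10 : velocityProb ω t .zero .minus = velocityProb ω t .zero .plus :=
    velocityProb_flip ω t .zero .plus
  cases σ <;> cases σ' <;> first | exact absurd rfl h | grind

/-! ### Coupled evolutions -/

theorem exists_noise_coupling {ω : ℝ} (hω : 0 < ω) {t : ℝ} (ht : 0 ≤ t) (σ σ' : Vel) :
    ∃ Γ : Measure (Noise × Noise), Γ.map Prod.fst = noiseLaw ∧ Γ.map Prod.snd = noiseLaw ∧
      (σ ≠ σ' → Γ {w | velocity ω σ w.1 t ≠ velocity ω σ' w.2 t}
        ≤ ENNReal.ofReal (Real.exp (-2 * ω * t))) ∧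
      (σ = σ' → Γ = noiseLaw.map (fun w => (w, w))) := by
  by_cases h : σ = σ'
  · have hm : Measurable (fun w : Noise => (w, w)) := measurable_id.prodMk measurable_id
    refine ⟨noiseLaw.map (fun w => (w, w)), ?_, ?_, fun h' => absurd h h', fun _ => rfl⟩
    · rw [Measure.map_map measurable_fst hm]; exact Measure.map_id
    · rw [Measure.map_map measurable_snd hm]; exact Measure.map_id
  · obtain ⟨Γ, h1, h2, h3⟩ := exists_maximal_coupling noiseLaw (measurable_velocity ω t σ)
      (measurable_velocity ω t σ')
    exact ⟨Γ, h1, h2, fun _ => h3.trans (ENNReal.ofReal_le_ofReal (velocityProb_overlap hω ht h)),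
      fun h' => absurd h' h⟩

/-- The coupling of the noises is chosen from the initial velocities only. These take finitely many
values, so measurability of the kernel is automatic. -/
theorem exists_coupled_evolve (ω μ v t : ℝ) {η η' : Measure State} [IsProbabilityMeasure η]
    [IsProbabilityMeasure η'] {γ : Measure (State × State)} (hγ : γ ∈ couplings η η')
    {Γ : Vel → Vel → Measure (Noise × Noise)} (h1 : ∀ σ σ', (Γ σ σ').map Prod.fst = noiseLaw)
    (h2 : ∀ σ σ', (Γ σ σ').map Prod.snd = noiseLaw) :
    ∃ γ' ∈ couplings (evolve ω μ v η t) (evolve ω μ v η' t),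
      ∀ f : State × State → ℝ≥0∞, Measurable f →
        ∫⁻ z, f z ∂γ' = ∫⁻ z, ∫⁻ w, f (process ω μ v z.1 w.1 t, process ω μ v z.2 w.2 t)
          ∂(Γ z.1.2 z.2.2) ∂γ := by
  have hprob : ∀ σ σ', IsProbabilityMeasure (Γ σ σ') := fun σ σ' =>
    (Measure.isProbabilityMeasure_map_iff measurable_fst.aemeasurable).1
      (by rw [h1 σ σ']; infer_instance)
  have hγp : IsProbabilityMeasure γ :=
    (Measure.isProbabilityMeasure_map_iff measurable_fst.aemeasurable).1
      (by rw [hγ.1]; infer_instance)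
  let κ : Kernel (State × State) (Noise × Noise) :=
    { toFun := fun z => Γ z.1.2 z.2.2
      measurable' := (measurable_of_countable (fun s : Vel × Vel => Γ s.1 s.2)).comp
        (measurable_fst.snd.prodMk measurable_snd.snd) }
  have hκ : IsMarkovKernel κ := ⟨fun z => hprob _ _⟩
  let Φ : (State × State) × (Noise × Noise) → State × State :=
    fun q => (process ω μ v q.1.1 q.2.1 t, process ω μ v q.1.2 q.2.2 t)
  have hΦ : Measurable Φ :=
    ((measurable_process ω μ v t).comp (measurable_fst.fst.prodMk measurable_snd.fst)).prodMk
      ((measurable_process ω μ v t).comp (measurable_fst.snd.prodMk measurable_snd.snd))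
  have hint : ∀ f : State × State → ℝ≥0∞, Measurable f →
      ∫⁻ z, f z ∂((γ ⊗ₘ κ).map Φ) = ∫⁻ z, ∫⁻ w, f (process ω μ v z.1 w.1 t, process ω μ v z.2 w.2 t)
          ∂(Γ z.1.2 z.2.2) ∂γ := fun f hf => by
    rw [lintegral_map hf hΦ]
    exact Measure.lintegral_compProd (hf.comp hΦ)
  refine ⟨(γ ⊗ₘ κ).map Φ, ⟨?_, ?_⟩, hint⟩
  · refine Measure.ext_of_lintegral _ fun f hf => ?_
    rw [lintegral_map hf measurable_fst, hint (fun z => f z.1) (hf.comp measurable_fst),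
      lintegral_evolve _ _ _ _ _ hf, ← hγ.1,
      lintegral_map (measurable_transition ω μ v t hf) measurable_fst]
    refine lintegral_congr fun z => ?_
    rw [transition, ← h1 z.1.2 z.2.2]
    exact (lintegral_map (hf.comp (measurable_process_noise ω μ v t z.1)) measurable_fst).symm
  · refine Measure.ext_of_lintegral _ fun f hf => ?_
    rw [lintegral_map hf measurable_snd, hint (fun z => f z.2) (hf.comp measurable_snd),
      lintegral_evolve _ _ _ _ _ hf, ← hγ.2,
      lintegral_map (measurable_transition ω μ v t hf) measurable_snd]
    refine lintegral_congr fun z => ?_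
    rw [transition, ← h2 z.1.2 z.2.2]
    exact (lintegral_map (hf.comp (measurable_process_noise ω μ v t z.2)) measurable_snd).symm

/-- A bound on both positions that is preserved by the dynamics. -/
noncomputable def pairMax (μ v : ℝ) (z : State × State) : ℝ :=
  max (max (z.1.1 : ℝ) (v / μ)) (max (z.2.1 : ℝ) (v / μ))

theorem measurable_pairMax (μ v : ℝ) : Measurable (pairMax μ v) := by
  unfold pairMax; fun_prop

theorem abs_sub_le_pairMax (μ v : ℝ) (z : State × State) :
    |(z.1.1 : ℝ) - z.2.1| ≤ pairMax μ v z := by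
  have h1 : (z.1.1 : ℝ) ≤ pairMax μ v z := (le_max_left _ _).trans (le_max_left _ _)
  have h2 : (z.2.1 : ℝ) ≤ pairMax μ v z := (le_max_left _ _).trans (le_max_right _ _)
  rw [abs_le]
  constructor <;> linarith [z.1.1.2, z.2.1.2, show (0 : ℝ) ≤ (z.1.1 : ℝ) from z.1.1.2,
    show (0 : ℝ) ≤ (z.2.1 : ℝ) from z.2.1.2]

theorem pairMax_nonneg (μ v : ℝ) (z : State × State) : 0 ≤ pairMax μ v z :=
  (abs_nonneg _).trans (abs_sub_le_pairMax μ v z)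

theorem measurableSet_vel_ne : MeasurableSet {z : State × State | z.1.2 ≠ z.2.2} :=
  (measurableSet_eq_fun measurable_fst.snd measurable_snd.snd).compl

/-- The `p`-th power of the distance between the positions. -/
noncomputable def posCost (p : ℝ) (z : State × State) : ℝ≥0∞ :=
  ENNReal.ofReal (|(z.1.1 : ℝ) - z.2.1| ^ p)

/-- The `p`-th power of `pairMax`. -/
noncomputable def maxCost (μ v p : ℝ) (z : State × State) : ℝ≥0∞ :=
  ENNReal.ofReal (pairMax μ v z ^ p)

theorem measurable_posCost (p : ℝ) : Measurable (posCost p) := by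
  unfold posCost; fun_prop

theorem measurable_maxCost (μ v p : ℝ) : Measurable (maxCost μ v p) :=
  ((measurable_pairMax μ v).pow_const p).ennreal_ofReal

theorem posCost_le_maxCost (μ v : ℝ) {p : ℝ} (hp : 0 ≤ p) (z : State × State) :
    posCost p z ≤ maxCost μ v p z :=
  ENNReal.ofReal_le_ofReal (Real.rpow_le_rpow (abs_nonneg _) (abs_sub_le_pairMax μ v z) hp)

/-- One stage of the coupling: common noise for equal velocities, maximal coupling at time `t` for
different ones. One coupling serves all exponents `p`; the exponent `0`, where `maxCost` is `1`,
controls the mismatch probability. -/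
theorem exists_contracting_coupling {ω μ v : ℝ} (hω : 0 < ω) (hμ : 0 < μ) (hv : 0 < v) {t : ℝ}
    (ht : 0 ≤ t) {η η' : Measure State} [IsProbabilityMeasure η] [IsProbabilityMeasure η']
    {γ : Measure (State × State)} (hγ : γ ∈ couplings η η') :
    ∃ γ' ∈ couplings (evolve ω μ v η t) (evolve ω μ v η' t), ∀ p : ℝ, 0 ≤ p →
      (∫⁻ z, maxCost μ v p z ∂γ' ≤ ∫⁻ z, maxCost μ v p z ∂γ) ∧
      (∫⁻ z, {z : State × State | z.1.2 ≠ z.2.2}.indicator (maxCost μ v p) z ∂γ'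
        ≤ ENNReal.ofReal (Real.exp (-2 * ω * t))
          * ∫⁻ z, {z : State × State | z.1.2 ≠ z.2.2}.indicator (maxCost μ v p) z ∂γ) ∧
      (∫⁻ z, posCost p z ∂γ' ≤ ENNReal.ofReal (Real.exp (-2 * μ * p * t)) * ∫⁻ z, posCost p z ∂γ
        + ∫⁻ z, {z : State × State | z.1.2 ≠ z.2.2}.indicator (maxCost μ v p) z ∂γ) := by
  choose Γ h1 h2 h3 h4 using fun σ σ' => exists_noise_coupling hω ht σ σ'
  obtain ⟨γ', hγ', hint⟩ := exists_coupled_evolve ω μ v t hγ h1 h2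
  have hprob : ∀ σ σ', IsProbabilityMeasure (Γ σ σ') := fun σ σ' =>
    (Measure.isProbabilityMeasure_map_iff measurable_fst.aemeasurable).1
      (by rw [h1 σ σ']; infer_instance)
  -- The confinement is pathwise, so it holds under any coupling of the noises.
  have hmax : ∀ p : ℝ, 0 ≤ p → ∀ z : State × State, ∀ᵐ w ∂(Γ z.1.2 z.2.2),
      maxCost μ v p (process ω μ v z.1 w.1 t, process ω μ v z.2 w.2 t) ≤ maxCost μ v p z := by
    intro p hp z
    have ha : ∀ᵐ w ∂(Γ z.1.2 z.2.2), ∀ i, 0 ≤ (w.1 i).1 :=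
      ae_of_ae_map measurable_fst.aemeasurable (by rw [h1 z.1.2 z.2.2]; exact ae_clock_nonneg)
    have hb : ∀ᵐ w ∂(Γ z.1.2 z.2.2), ∀ i, 0 ≤ (w.2 i).1 :=
      ae_of_ae_map measurable_snd.aemeasurable (by rw [h2 z.1.2 z.2.2]; exact ae_clock_nonneg)
    filter_upwards [ha, hb] with w hwa hwb
    refine ENNReal.ofReal_le_ofReal (Real.rpow_le_rpow (pairMax_nonneg _ _ _) ?_ hp)
    exact max_le_max (max_le (process_le_max hω hμ hv _ hwa ht) (le_max_right _ _))
      (max_le (process_le_max hω hμ hv _ hwb ht) (le_max_right _ _))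
  have hN := measurableSet_vel_ne
  refine ⟨γ', hγ', fun p hp => ⟨?_, ?_, ?_⟩⟩
  · rw [hint _ (measurable_maxCost μ v p)]
    refine lintegral_mono fun z => (lintegral_mono_ae (hmax p hp z)).trans ?_
    simp
  · rw [hint _ ((measurable_maxCost μ v p).indicator hN),
      ← lintegral_const_mul _ ((measurable_maxCost μ v p).indicator hN)]
    refine lintegral_mono fun z => ?_
    by_cases hz : z.1.2 = z.2.2
    · rw [h4 _ _ hz, lintegral_map]
      · simp [process_snd, hz]
      · exact ((measurable_maxCost μ v p).indicator hN).comp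
          (((measurable_process_noise ω μ v t z.1).comp measurable_fst).prodMk
            ((measurable_process_noise ω μ v t z.2).comp measurable_snd))
      · exact measurable_id.prodMk measurable_id
    · rw [Set.indicator_of_mem (by exact hz)]
      have hS : MeasurableSet {w : Noise × Noise |
          velocity ω z.1.2 w.1 t ≠ velocity ω z.2.2 w.2 t} :=
        (measurableSet_eq_fun ((measurable_velocity ω t z.1.2).comp measurable_fst)
          ((measurable_velocity ω t z.2.2).comp measurable_snd)).compl
      calc _ ≤ ∫⁻ w, {w : Noise × Noise |
              velocity ω z.1.2 w.1 t ≠ velocity ω z.2.2 w.2 t}.indicator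
                (fun _ => maxCost μ v p z) w ∂(Γ z.1.2 z.2.2) := by
            refine lintegral_mono_ae ((hmax p hp z).mono fun w hw => ?_)
            by_cases h : velocity ω z.1.2 w.1 t = velocity ω z.2.2 w.2 t
            · simp [process_snd, h]
            · simpa [process_snd, h] using hw
        _ = maxCost μ v p z * Γ z.1.2 z.2.2 {w : Noise × Noise |
              velocity ω z.1.2 w.1 t ≠ velocity ω z.2.2 w.2 t} := lintegral_indicator_const hS _
        _ ≤ _ := by rw [mul_comm]; gcongr; exact h3 _ _ hz
  · rw [hint _ (measurable_posCost p), ← lintegral_const_mul _ (measurable_posCost p),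
      ← lintegral_add_left ((measurable_posCost p).const_mul _)]
    refine lintegral_mono fun z => ?_
    by_cases hz : z.1.2 = z.2.2
    · rw [h4 _ _ hz, lintegral_map]
      · rw [Set.indicator_of_notMem (by simpa using hz), add_zero]
        refine (lintegral_mono fun w => ?_).trans (by simp : ∫⁻ _, ENNReal.ofReal
          (Real.exp (-2 * μ * p * t)) * posCost p z ∂noiseLaw ≤ _)
        rw [posCost, posCost, ← ENNReal.ofReal_mul (Real.exp_pos _).le]
        refine ENNReal.ofReal_le_ofReal ?_
        refine (Real.rpow_le_rpow (abs_nonneg _) (abs_process_sub_le ω μ v hz w t) hp).trans ?_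
        rw [Real.mul_rpow (Real.exp_pos _).le (abs_nonneg _), ← Real.exp_mul]
        refine le_of_eq ?_
        congr 2; ring
      · exact (measurable_posCost p).comp
          (((measurable_process_noise ω μ v t z.1).comp measurable_fst).prodMk
            ((measurable_process_noise ω μ v t z.2).comp measurable_snd))
      · exact measurable_id.prodMk measurable_id
    · rw [Set.indicator_of_mem (by exact hz)]
      refine le_add_left ?_
      refine (lintegral_mono_ae ((hmax p hp z).mono fun w hw =>
        (posCost_le_maxCost μ v hp _).trans hw)).trans ?_
      simp

theorem maxCost_le_add (μ v p : ℝ) (z : State × State) :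
    maxCost μ v p z ≤ ENNReal.ofReal (max (z.1.1 : ℝ) (v / μ) ^ p)
      + ENNReal.ofReal (max (z.2.1 : ℝ) (v / μ) ^ p) := by
  unfold maxCost pairMax
  rcases max_choice (max (z.1.1 : ℝ) (v / μ)) (max (z.2.1 : ℝ) (v / μ)) with h | h <;> rw [h]
  · exact le_self_add
  · exact le_add_self

/-- The contraction of the mixed distance along the process. -/
theorem mixedDist_evolve_le {ω μ v : ℝ} (hω : 0 < ω) (hμ : 0 < μ) (hv : 0 < v) {p : ℝ} (hp : 1 ≤ p)
    (η η' : Measure State) [IsProbabilityMeasure η] [IsProbabilityMeasure η'] {t : ℝ}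
    (ht : 0 ≤ t) :
    mixedDist p (evolve ω μ v η t) (evolve ω μ v η' t)
      ≤ ENNReal.ofReal ((2 : ℝ) ^ (1 / p)) * (momentF μ v p η + momentF μ v p η')
          * ENNReal.ofReal (Real.exp (-(2 * ω * μ / (ω + p * μ)) * t))
        + ENNReal.ofReal (Real.exp (-2 * ω * t)) := by
  have hp0 : 0 < p := by linarith
  have hD : 0 < ω + p * μ := by positivity
  -- The solution of `ω * u = p * μ * (t - u)`: the mismatch probability after the first stage then
  -- equals the contraction factor of the `p`-th power over the second.
  set u : ℝ := p * μ * t / (ω + p * μ) with hu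
  have hu0 : 0 ≤ u := by positivity
  have hut : t - u = ω * t / (ω + p * μ) := by rw [hu]; field_simp; ring
  have hut0 : 0 ≤ t - u := by rw [hut]; positivity
  -- Any initial coupling would do, since only the two marginal moments enter.
  have hγ : η.prod η' ∈ couplings η η' := ⟨by simp [Measure.map_fst_prod], by
    simp [Measure.map_snd_prod]⟩
  obtain ⟨γ₁, hγ₁, H₁⟩ := exists_contracting_coupling hω hμ hv hu0 hγ
  obtain ⟨γ₂, hγ₂, H₂⟩ := exists_contracting_coupling hω hμ hv hut0 hγ₁
  rw [evolve_evolve hω hμ v η hu0 hut0, evolve_evolve hω hμ v η' hu0 hut0,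
    add_sub_cancel] at hγ₂
  have hN := measurableSet_vel_ne
  have hone : ∀ γ : Measure (State × State),
      ∫⁻ z, {z : State × State | z.1.2 ≠ z.2.2}.indicator (maxCost μ v 0) z ∂γ
        = γ {z | z.1.2 ≠ z.2.2} := fun γ => by
    rw [← lintegral_indicator_one hN]
    congr with z
    simp [Set.indicator_apply, maxCost]
  refine (iInf₂_le γ₂ hγ₂).trans (add_le_add ?_ ?_)
  · set e : ℝ := Real.exp (-2 * ω * u) with he
    have he' : Real.exp (-2 * μ * p * (t - u)) = e := by
      rw [he, hut, hu]; congr 1; field_simp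
    have hM : ∫⁻ z, maxCost μ v p z ∂(η.prod η')
        ≤ ∫⁻ z, ENNReal.ofReal (max (z.1 : ℝ) (v / μ) ^ p) ∂η
          + ∫⁻ z, ENNReal.ofReal (max (z.1 : ℝ) (v / μ) ^ p) ∂η' := by
      have hm : Measurable fun z : State => ENNReal.ofReal (max (z.1 : ℝ) (v / μ) ^ p) := by
        fun_prop
      refine (lintegral_mono (maxCost_le_add μ v p)).trans ?_
      refine (le_of_eq (lintegral_add_left (hm.comp measurable_fst) _)).trans (le_of_eq ?_)
      congr 1
      · conv_rhs => rw [← hγ.1, lintegral_map hm measurable_fst]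
        rfl
      · conv_rhs => rw [← hγ.2, lintegral_map hm measurable_snd]
    -- One factor `e` comes from the pairs matched at time `u`, which contract afterwards, the other
    -- from the pairs still mismatched then.
    have hI : ∫⁻ z, posCost p z ∂γ₂ ≤ ENNReal.ofReal (2 * e) *
        (∫⁻ z, ENNReal.ofReal (max (z.1 : ℝ) (v / μ) ^ p) ∂η
          + ∫⁻ z, ENNReal.ofReal (max (z.1 : ℝ) (v / μ) ^ p) ∂η') := by
      refine ((H₂ p hp0.le).2.2).trans ?_
      rw [he', two_mul, ENNReal.ofReal_add (Real.exp_pos _).le (Real.exp_pos _).le, add_mul]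
      refine add_le_add ?_ ?_
      · gcongr
        exact (lintegral_mono (posCost_le_maxCost μ v hp0.le)).trans
          ((H₁ p hp0.le).1.trans hM)
      · refine (H₁ p hp0.le).2.1.trans ?_
        gcongr
        exact (lintegral_mono (Set.indicator_le_self _ _)).trans hM
    refine (ENNReal.rpow_le_rpow hI (by positivity : 0 ≤ 1 / p)).trans ?_
    rw [ENNReal.mul_rpow_of_nonneg _ _ (by positivity),
      ENNReal.ofReal_rpow_of_nonneg (by positivity) (by positivity),
      Real.mul_rpow (by norm_num) (Real.exp_pos _).le, ← Real.exp_mul,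
      ENNReal.ofReal_mul (by positivity),
      show -2 * ω * u * (1 / p) = -(2 * ω * μ / (ω + p * μ)) * t by rw [hu]; field_simp]
    rw [mul_right_comm]
    gcongr
    exact ENNReal.rpow_add_le_add_rpow _ _ (by positivity) ((div_le_one hp0).2 hp)
  · rw [← hone]
    refine ((H₂ 0 le_rfl).2.1).trans ?_
    refine (mul_le_mul_right (H₁ 0 le_rfl).2.1 _).trans ?_
    rw [hone, ← mul_assoc, ← ENNReal.ofReal_mul (Real.exp_pos _).le, ← Real.exp_add]
    refine (mul_le_of_le_one_right' prob_le_one).trans (le_of_eq ?_)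
    congr 2; ring

/-! ### Weak convergence and the mixed distance -/

instance : TopologicalSpace Vel := ⊥

instance : DiscreteTopology Vel := ⟨rfl⟩

instance : BorelSpace Vel := ⟨borel_eq_top_of_discrete.symm⟩

theorem mixedDist_comm_le (p : ℝ) (η η' : Measure State) : mixedDist p η η' ≤ mixedDist p η' η := by
  refine le_iInf₂ fun γ hγ => ?_
  have hmem : γ.map Prod.swap ∈ couplings η η' := by
    refine ⟨?_, ?_⟩
    · rw [Measure.map_map measurable_fst measurable_swap]; exact hγ.2
    · rw [Measure.map_map measurable_snd measurable_swap]; exact hγ.1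
  refine (iInf₂_le _ hmem).trans (le_of_eq ?_)
  congr 1
  · congr 1
    refine (lintegral_map (measurable_posCost p) measurable_swap).trans ?_
    simp only [posCost, Prod.fst_swap, Prod.snd_swap, abs_sub_comm]
  · rw [Measure.map_apply measurable_swap measurableSet_vel_ne]
    congr 1
    ext z
    exact ne_comm

theorem mixedDist_comm (p : ℝ) (η η' : Measure State) : mixedDist p η η' = mixedDist p η' η :=
  le_antisymm (mixedDist_comm_le p η η') (mixedDist_comm_le p η' η)

/-- The half-line `{x ≤ a}` at the velocity `σ`. -/
def halfLine (σ : Vel) (a : ℝ≥0) : Set State := Set.Iic a ×ˢ {σ}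

theorem measurableSet_halfLine (σ : Vel) (a : ℝ≥0) : MeasurableSet (halfLine σ a) :=
  measurableSet_Iic.prod (measurableSet_singleton σ)

/-- Under a coupling, if the first point lies below `a` at velocity `σ`, then the second lies in
`halfLine σ b`, or the velocities differ, or the positions are at least `b - a` apart. Markov's
inequality bounds the last event. -/
theorem measure_halfLine_le (η η' : Measure State) (σ : Vel) {a b : ℝ≥0} (hab : a < b) :
    η (Set.Iio a ×ˢ {σ}) ≤ η' (halfLine σ b)
      + (1 + (ENNReal.ofReal (b - a))⁻¹) * mixedDist 1 η η' := by
  have hpos : (0 : ℝ) < b - a := sub_pos.2 (by exact_mod_cast hab)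
  have hc0 : (1 : ℝ≥0∞) + (ENNReal.ofReal (b - a))⁻¹ ≠ 0 := by simp
  have hct : (1 : ℝ≥0∞) + (ENNReal.ofReal (b - a))⁻¹ ≠ ⊤ := by simp [hab]
  -- Isolating `mixedDist` lets the inequality be checked for each coupling separately.
  rw [← tsub_le_iff_left, mul_comm, ← ENNReal.div_le_iff hc0 hct]
  refine le_iInf₂ fun γ hγ => ?_
  rw [ENNReal.div_le_iff hc0 hct, tsub_le_iff_left, ← hγ.1, ← hγ.2,
    Measure.map_apply measurable_fst (measurableSet_Iio.prod (measurableSet_singleton σ)),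
    Measure.map_apply measurable_snd (measurableSet_halfLine σ b)]
  have hsub : Prod.fst ⁻¹' (Set.Iio a ×ˢ {σ}) ⊆ Prod.snd ⁻¹' (halfLine σ b) ∪
      ({z : State × State | z.1.2 ≠ z.2.2} ∪ {z | ENNReal.ofReal (b - a) ≤ posCost 1 z}) := by
    rintro ⟨⟨x, s⟩, ⟨y, s'⟩⟩ ⟨hx, hs⟩
    simp only [Set.mem_Iio, Set.mem_singleton_iff] at hx hs
    by_cases h : s = s'
    · by_cases h' : y ≤ b
      · exact Or.inl ⟨h', h ▸ hs⟩
      · refine Or.inr (Or.inr (ENNReal.ofReal_le_ofReal ?_))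
        have hx' : (x : ℝ) < a := by exact_mod_cast hx
        have hy' : (b : ℝ) < y := by exact_mod_cast not_le.1 h'
        simp only [Real.rpow_one]
        rw [abs_sub_comm]
        exact le_trans (by linarith) (le_abs_self _)
    · exact Or.inr (Or.inl h)
  have hmk : γ {z | ENNReal.ofReal (b - a) ≤ posCost 1 z}
      ≤ (ENNReal.ofReal (b - a))⁻¹ * ∫⁻ z, posCost 1 z ∂γ := by
    rw [mul_comm, ← div_eq_mul_inv]
    exact meas_ge_le_lintegral_div (measurable_posCost 1).aemeasurable (by simpa using hpos)
      ENNReal.ofReal_ne_top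
  refine (measure_mono hsub).trans ((measure_union_le _ _).trans ?_)
  gcongr
  refine (measure_union_le _ _).trans ?_
  have hI : (∫⁻ z : State × State, ENNReal.ofReal (|(z.1.1 : ℝ) - z.2.1| ^ (1 : ℝ)) ∂γ) ^ (1 / (1 : ℝ))
      = ∫⁻ z, posCost 1 z ∂γ := by simp [posCost]
  rw [hI, add_comm]
  refine (add_le_add_left hmk _).trans ?_
  rw [mul_comm _ (1 + _), mul_add]
  gcongr
  · exact le_add_self
  · exact le_mul_of_one_le_left' le_self_add

theorem measure_halfLine_le_of_forall_lt {α β : Measure State} [IsFiniteMeasure β] {σ : Vel}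
    (h : ∀ a b : ℝ≥0, a < b → α (Set.Iio a ×ˢ {σ}) ≤ β (halfLine σ b)) (a : ℝ≥0) :
    α (halfLine σ a) ≤ β (halfLine σ a) := by
  obtain ⟨u, hu, hua, hlim⟩ := exists_seq_strictAnti_tendsto a
  have h1 : ∀ n, α (halfLine σ a) ≤ β (halfLine σ (u n)) := fun n => by
    obtain ⟨c, hac, hcu⟩ := exists_between (hua n)
    refine (measure_mono (Set.prod_mono ?_ le_rfl)).trans (h c (u n) hcu)
    exact fun x hx => lt_of_le_of_lt hx hac
  have h2 : halfLine σ a = ⋂ n, halfLine σ (u n) := by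
    ext z
    simp only [halfLine, Set.mem_prod, Set.mem_Iic, Set.mem_iInter, Set.mem_singleton_iff]
    exact ⟨fun hz n => ⟨hz.1.trans (hua n).le, hz.2⟩,
      fun hz => ⟨ge_of_tendsto' hlim fun n => (hz n).1, (hz 0).2⟩⟩
  have h3 := tendsto_measure_iInter_atTop (μ := β)
    (fun n => (measurableSet_halfLine σ (u n)).nullMeasurableSet)
    (fun m n hmn => Set.prod_mono (Set.Iic_subset_Iic.2 (hu.antitone hmn)) le_rfl)
    ⟨0, measure_ne_top β _⟩
  rw [← h2] at h3
  exact ge_of_tendsto' h3 h1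

theorem ext_of_halfLine {α β : Measure State} [IsFiniteMeasure α]
    (h : ∀ σ a, α (halfLine σ a) = β (halfLine σ a)) : α = β := by
  refine Measure.ext_prod fun {s t} hs ht => ?_
  have key : ∀ σ, α (s ×ˢ {σ}) = β (s ×ˢ {σ}) := by
    intro σ
    have hr : ∀ (ν : Measure State) {s : Set ℝ≥0}, MeasurableSet s →
        (ν.restrict (Prod.snd ⁻¹' {σ})).map Prod.fst s = ν (s ×ˢ {σ}) := fun ν s hs => by
      rw [Measure.map_apply measurable_fst hs, Measure.restrict_apply (measurable_fst hs)]
      congr 1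
    rw [← hr α hs, ← hr β hs]
    congr 1
    refine Measure.ext_of_Iic _ _ fun a => ?_
    rw [hr α measurableSet_Iic, hr β measurableSet_Iic]
    exact h σ a
  have hsum : ∀ ν : Measure State, ν (s ×ˢ t) = ∑' σ : t, ν (s ×ˢ {(σ : Vel)}) := fun ν => by
    have h1 := tsum_measure_preimage_singleton (μ := ν.restrict (Prod.fst ⁻¹' s))
      t.to_countable (f := Prod.snd) fun σ _ => measurable_snd (measurableSet_singleton σ)
    rw [Measure.restrict_apply (measurable_snd ht), Set.inter_comm] at h1
    refine h1.symm.trans (tsum_congr fun σ => ?_)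
    rw [Measure.restrict_apply (measurable_snd (measurableSet_singleton _)), Set.inter_comm]
    rfl
  rw [hsum, hsum]
  exact tsum_congr fun σ => key σ

/-- The portmanteau inequalities apply to the open set on the left and to the closed one on the
right; the gap `a < b` keeps the constant of the half-line estimate finite. -/
theorem measure_Iio_le_of_tendsto {ι : Type*} {L : Filter ι} [L.NeBot]
    {αs βs : ι → ProbabilityMeasure State} {α β : ProbabilityMeasure State}
    (hα : Tendsto αs L (𝓝 α)) (hβ : Tendsto βs L (𝓝 β))
    (hd : Tendsto (fun i => mixedDist 1 (αs i : Measure State) (βs i : Measure State)) L (𝓝 0))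
    (σ : Vel) {a b : ℝ≥0} (hab : a < b) :
    (α : Measure State) (Set.Iio a ×ˢ {σ}) ≤ (β : Measure State) (halfLine σ b) := by
  have hpos : (0 : ℝ) < b - a := sub_pos.2 (by exact_mod_cast hab)
  have hopen := ProbabilityMeasure.le_liminf_measure_open_of_tendsto hα
    (isOpen_Iio.prod (isOpen_discrete {σ}) : IsOpen (Set.Iio a ×ˢ {σ}))
  have hclosed := ProbabilityMeasure.limsup_measure_closed_le_of_tendsto hβ
    (isClosed_Iic.prod (isClosed_discrete {σ}) : IsClosed (halfLine σ b))
  have hd' : Tendsto (fun i => (1 + (ENNReal.ofReal (b - a))⁻¹)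
      * mixedDist 1 (αs i : Measure State) (βs i : Measure State)) L (𝓝 0) := by
    simpa using ENNReal.Tendsto.const_mul hd (Or.inr (by simp [hab]))
  refine ENNReal.le_of_forall_pos_le_add fun ε hε hfin => ?_
  have hε' : (0 : ℝ≥0∞) < (ε / 2 : ℝ≥0) := by exact_mod_cast half_pos hε
  have h1 := eventually_lt_of_limsup_lt
    (hclosed.trans_lt (ENNReal.lt_add_right hfin.ne hε'.ne'))
  have h2 := hd'.eventually_lt_const hε'
  refine hopen.trans (liminf_le_of_frequently_le' (Eventually.frequently ?_))
  filter_upwards [h1, h2] with i hi hi'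
  refine (measure_halfLine_le _ _ σ hab).trans ((add_le_add hi.le hi'.le).trans (le_of_eq ?_))
  rw [add_assoc, ← ENNReal.coe_add, add_halves]
  rfl

/-- Half-lines determine a finite measure, so this route needs neither a triangle inequality nor
lower semicontinuity of `mixedDist`. -/
theorem eq_of_tendsto_of_mixedDist_tendsto {ι : Type*} {L : Filter ι} [L.NeBot]
    {αs βs : ι → ProbabilityMeasure State} {α β : ProbabilityMeasure State}
    (hα : Tendsto αs L (𝓝 α)) (hβ : Tendsto βs L (𝓝 β))
    (hd : Tendsto (fun i => mixedDist 1 (αs i : Measure State) (βs i : Measure State)) L (𝓝 0)) :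
    α = β := by
  refine Subtype.ext (show (α : Measure State) = β from
    ext_of_halfLine fun σ a => le_antisymm ?_ ?_)
  · exact measure_halfLine_le_of_forall_lt
      (fun a b hab => measure_Iio_le_of_tendsto hα hβ hd σ hab) a
  · simp_rw [mixedDist_comm 1 (αs _ : Measure State)] at hd
    exact measure_halfLine_le_of_forall_lt
      (fun a b hab => measure_Iio_le_of_tendsto hβ hα hd σ hab) a

/-! ### The Feller property -/

theorem continuous_process (ω μ v t : ℝ) (w : Noise) :
    Continuous (fun z => process ω μ v z w t) := by
  refine continuous_prod_of_discrete_right.2 fun σ => Continuous.prodMk ?_ ?_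
  · refine (LipschitzWith.of_dist_le_mul (K := ⟨Real.exp (-2 * μ * t), (Real.exp_pos _).le⟩)
      fun x y => ?_).continuous
    exact abs_process_sub_le ω μ v (z := (x, σ)) (z' := (y, σ)) rfl w t
  · change Continuous fun x => (process ω μ v (x, σ) w t).2
    simp only [process_snd]
    exact continuous_const

/-- The evolution of a probability measure. -/
noncomputable def evolveProb (ω μ v t : ℝ) (η : ProbabilityMeasure State) :
    ProbabilityMeasure State := ⟨evolve ω μ v η t, inferInstance⟩

/-- By duality: for fixed noise the path is continuous in the initial state, so averaging a bounded
continuous test function over the noise gives another one. -/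
theorem continuous_evolveProb (ω μ v t : ℝ) : Continuous (evolveProb ω μ v t) := by
  refine continuous_iff_continuousAt.2 fun η => ?_
  refine ProbabilityMeasure.tendsto_iff_forall_integral_tendsto.2 fun f => ?_
  have hcont : Continuous fun z => ∫ w, f (process ω μ v z w t) ∂noiseLaw := by
    refine continuous_of_dominated (bound := fun _ => ‖f‖) (fun z => ?_)
      (fun z => Eventually.of_forall fun w => f.norm_coe_le_norm _) (integrable_const _)
      (Eventually.of_forall fun w => f.continuous.comp (continuous_process ω μ v t w))
    exact (f.continuous.measurable.comp (measurable_process_noise ω μ v t z)).aestronglyMeasurable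
  let g : State →ᵇ ℝ := BoundedContinuousFunction.ofNormedAddCommGroup _ hcont ‖f‖ fun z => by
    refine (norm_integral_le_of_norm_le_const
      (Eventually.of_forall fun w => f.norm_coe_le_norm _)).trans ?_
    simp
  have hint : ∀ η : ProbabilityMeasure State,
      ∫ z, f z ∂(evolveProb ω μ v t η : Measure State) = ∫ z, g z ∂(η : Measure State) := fun η => by
    change ∫ z, f z ∂(evolve ω μ v η t) = _
    have hm := f.continuous.measurable.comp (measurable_process ω μ v t)
    rw [evolve, integral_map (measurable_process ω μ v t).aemeasurable
      f.continuous.measurable.aestronglyMeasurable]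
    refine integral_prod _ (Integrable.of_bound hm.aestronglyMeasurable ‖f‖ ?_)
    exact Eventually.of_forall fun q => f.norm_coe_le_norm _
  simp_rw [hint]
  exact ProbabilityMeasure.tendsto_iff_forall_integral_tendsto.1 tendsto_id g

/-! ### Moments and invariant measures -/

theorem momentF_mono (μ v : ℝ) {p q : ℝ} (hp : 0 < p) (hpq : p ≤ q) (η : Measure State)
    [IsProbabilityMeasure η] (hvμ : 0 ≤ v / μ) : momentF μ v p η ≤ momentF μ v q η := by
  have h : ∀ r : ℝ, 0 < r →
      momentF μ v r η = eLpNorm' (fun z : State => max (z.1 : ℝ) (v / μ)) r η := fun r hr => by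
    unfold momentF eLpNorm'
    congr 1
    refine lintegral_congr fun z => ?_
    have h0 : 0 ≤ max (z.1 : ℝ) (v / μ) := hvμ.trans (le_max_right _ _)
    rw [← ENNReal.ofReal_rpow_of_nonneg h0 hr.le, Real.enorm_of_nonneg h0]
  rw [h p hp, h q (hp.trans_le hpq)]
  refine eLpNorm'_le_eLpNorm'_of_exponent_le hp hpq η (Measurable.aestronglyMeasurable ?_)
  fun_prop

theorem momentF_of_ae_le {μ v p : ℝ} (hvμ : 0 ≤ v / μ) (hp : 0 < p) {η : Measure State}
    [IsProbabilityMeasure η] (h : ∀ᵐ z ∂η, (z.1 : ℝ) ≤ v / μ) :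
    momentF μ v p η = ENNReal.ofReal (v / μ) := by
  have : ∫⁻ z, ENNReal.ofReal (max (z.1 : ℝ) (v / μ) ^ p) ∂η = ENNReal.ofReal ((v / μ) ^ p) := by
    rw [lintegral_congr_ae (h.mono fun z hz => by
      change _ = (fun _ => ENNReal.ofReal ((v / μ) ^ p)) z
      simp only [max_eq_right hz])]
    simp
  rw [momentF, this, ENNReal.ofReal_rpow_of_nonneg (by positivity) (by positivity),
    ← Real.rpow_mul hvμ, mul_one_div_cancel hp.ne', Real.rpow_one]

theorem momentF_dirac_ne_top (μ v p : ℝ) (hp : 0 < p) (z : State) :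
    momentF μ v p (Measure.dirac z) ≠ ⊤ := by
  rw [momentF, lintegral_dirac' _ (by fun_prop)]
  exact ENNReal.rpow_ne_top_of_nonneg (by positivity) ENNReal.ofReal_ne_top

theorem ae_evolve_le {ω μ v : ℝ} (hω : 0 < ω) (hμ : 0 < μ) (hv : 0 < v) {η : Measure State}
    [IsProbabilityMeasure η] {t : ℝ} (ht : 0 ≤ t) (h : ∀ᵐ z ∂η, (z.1 : ℝ) ≤ v / μ) :
    ∀ᵐ z ∂(evolve ω μ v η t), (z.1 : ℝ) ≤ v / μ := by
  refine (ae_map_iff (measurable_process ω μ v t).aemeasurable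
    (measurableSet_le (by fun_prop) measurable_const)).2 ?_
  have h1 : ∀ᵐ p ∂(η.prod noiseLaw), (p.1.1 : ℝ) ≤ v / μ :=
    Measure.quasiMeasurePreserving_fst.ae h
  have h2 : ∀ᵐ p ∂(η.prod noiseLaw), ∀ i, 0 ≤ (p.2 i).1 :=
    Measure.quasiMeasurePreserving_snd.ae ae_clock_nonneg
  filter_upwards [h1, h2] with p hp1 hp2
  exact (process_le_max hω hμ hv p.1 hp2 ht).trans (max_le hp1 le_rfl)

theorem tendsto_exp_bound {c d : ℝ} (hc : 0 < c) (hd : 0 < d) {A : ℝ≥0∞} (hA : A ≠ ⊤) :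
    Tendsto (fun n : ℕ => A * ENNReal.ofReal (Real.exp (-c * n))
      + ENNReal.ofReal (Real.exp (-d * n))) atTop (𝓝 0) := by
  have h : ∀ c : ℝ, 0 < c →
      Tendsto (fun n : ℕ => ENNReal.ofReal (Real.exp (-c * n))) atTop (𝓝 0) := fun c hc => by
    have : Tendsto (fun n : ℕ => Real.exp (-c * n)) atTop (𝓝 0) :=
      Real.tendsto_exp_atBot.comp
        (tendsto_natCast_atTop_atTop.const_mul_atTop_of_neg (neg_lt_zero.2 hc))
    simpa using ENNReal.tendsto_ofReal this
  simpa using (ENNReal.Tendsto.const_mul (h c hc) (Or.inr hA)).add (h d hd)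

theorem tendsto_mixedDist_evolve {ω μ v : ℝ} (hω : 0 < ω) (hμ : 0 < μ) (hv : 0 < v)
    {η η' : Measure State} [IsProbabilityMeasure η] [IsProbabilityMeasure η']
    (h : ∀ᵐ z ∂η, (z.1 : ℝ) ≤ v / μ) (h' : ∀ᵐ z ∂η', (z.1 : ℝ) ≤ v / μ) :
    Tendsto (fun n : ℕ => mixedDist 1 (evolve ω μ v η n) (evolve ω μ v η' n)) atTop (𝓝 0) := by
  have hvμ : 0 ≤ v / μ := by positivity
  refine tendsto_of_tendsto_of_tendsto_of_le_of_le tendsto_const_nhds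
    (tendsto_exp_bound (c := 2 * ω * μ / (ω + 1 * μ)) (d := 2 * ω) (by positivity) (by positivity)
      (A := ENNReal.ofReal ((2 : ℝ) ^ (1 / (1 : ℝ))) * (momentF μ v 1 η + momentF μ v 1 η')) ?_)
    (fun _ => zero_le) fun n => ?_
  · rw [momentF_of_ae_le hvμ one_pos h, momentF_of_ae_le hvμ one_pos h']
    exact ENNReal.mul_ne_top ENNReal.ofReal_ne_top (by simp)
  · have := mixedDist_evolve_le hω hμ hv le_rfl η η' (Nat.cast_nonneg n)
    simpa only [neg_mul] using this

/-- The excess over `v / μ` shrinks by `exp (-2 * μ * n)` along every path, while invariance keeps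
its law fixed. Truncating it at `1` permits dominated convergence without any moment assumption. -/
theorem ae_le_of_invariant {ω μ v : ℝ} (hω : 0 < ω) (hμ : 0 < μ) (hv : 0 < v) {π : Measure State}
    (hπ : IsInvariantProbability ω μ v π) : ∀ᵐ z ∂π, (z.1 : ℝ) ≤ v / μ := by
  have := hπ.1
  let h : ℝ → State → ℝ≥0∞ := fun e z => ENNReal.ofReal (min 1 (e * max 0 ((z.1 : ℝ) - v / μ)))
  have hm : ∀ e, Measurable (h e) := fun e => by fun_prop
  have hle : ∀ n : ℕ, ∫⁻ z, h 1 z ∂π ≤ ∫⁻ z, h (Real.exp (-2 * μ * n)) z ∂π := by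
    intro n
    conv_lhs => rw [← hπ.2 n (Nat.cast_nonneg n)]
    rw [lintegral_evolve _ _ _ _ _ (hm 1)]
    refine lintegral_mono fun z => ?_
    refine (lintegral_mono_ae (g := fun _ => h (Real.exp (-2 * μ * n)) z)
      (ae_clock_nonneg.mono fun w hw => ?_)).trans (by simp)
    refine ENNReal.ofReal_le_ofReal (min_le_min le_rfl ?_)
    rw [one_mul]
    exact max_zero_le_of_le_mul_max (Real.exp_pos _).le
      (process_sub_le hω hμ hv z hw (Nat.cast_nonneg n))
  have hlim : Tendsto (fun n : ℕ => ∫⁻ z, h (Real.exp (-2 * μ * n)) z ∂π) atTop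
      (𝓝 (∫⁻ _, 0 ∂π)) := by
    refine tendsto_lintegral_of_dominated_convergence (fun _ => 1) (fun n => hm _)
      (fun n => Eventually.of_forall fun z => ?_) (by simp) (Eventually.of_forall fun z => ?_)
    · exact ENNReal.ofReal_le_one.2 (min_le_left _ _)
    · have he : Tendsto (fun n : ℕ => Real.exp (-2 * μ * n)) atTop (𝓝 0) :=
        Real.tendsto_exp_atBot.comp
          (tendsto_natCast_atTop_atTop.const_mul_atTop_of_neg (by linarith))
      have := ENNReal.tendsto_ofReal
        (tendsto_const_nhds (x := (1 : ℝ)).min (he.mul_const (max 0 ((z.1 : ℝ) - v / μ))))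
      simpa [h] using this
  have h0 : ∫⁻ z, h 1 z ∂π = 0 := by
    refine le_antisymm ?_ zero_le
    simpa using ge_of_tendsto' hlim hle
  filter_upwards [(lintegral_eq_zero_iff (hm 1)).1 h0] with z hz
  simp only [h, Pi.zero_apply, ENNReal.ofReal_eq_zero, one_mul] at hz
  by_contra hlt
  have : 0 < min 1 (max 0 ((z.1 : ℝ) - v / μ)) :=
    lt_min one_pos (lt_max_of_lt_right (by linarith))
  linarith

theorem invariant_unique {ω μ v : ℝ} (hω : 0 < ω) (hμ : 0 < μ) (hv : 0 < v) {π π' : Measure State}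
    (hπ : IsInvariantProbability ω μ v π) (hπ' : IsInvariantProbability ω μ v π') : π' = π := by
  have := hπ.1
  have := hπ'.1
  have h := tendsto_mixedDist_evolve hω hμ hv (ae_le_of_invariant hω hμ hv hπ')
    (ae_le_of_invariant hω hμ hv hπ)
  simp only [hπ.2 _ (Nat.cast_nonneg _), hπ'.2 _ (Nat.cast_nonneg _)] at h
  have := eq_of_tendsto_of_mixedDist_tendsto (L := (atTop : Filter ℕ))
    (αs := fun _ => ⟨π', hπ'.1⟩) (βs := fun _ => ⟨π, hπ.1⟩) tendsto_const_nhds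
    tendsto_const_nhds h
  exact congrArg Subtype.val this

/-- The laws `ν n` of the process started at `(0, .zero)` live on a fixed compact set and have a
limit `π` along an ultrafilter. By the Feller property their evolutions by `t` tend to `π P_t`, and
by the contraction they approach `ν n` itself. -/
theorem exists_invariant {ω μ v : ℝ} (hω : 0 < ω) (hμ : 0 < μ) (hv : 0 < v) :
    ∃ π : Measure State, IsInvariantProbability ω μ v π := by
  have hvμ : 0 ≤ v / μ := by positivity
  let c : ℝ≥0 := ⟨v / μ, hvμ⟩
  let K : Set State := Set.Iic c ×ˢ Set.univ
  have hK : IsCompact K := by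
    refine IsCompact.prod ?_ (Set.finite_univ.isCompact)
    rw [← Set.Icc_bot (a := c)]
    exact isCompact_Icc
  let δ : ProbabilityMeasure State := ⟨Measure.dirac (0, .zero), inferInstance⟩
  have hδ : ∀ᵐ z ∂(δ : Measure State), (z.1 : ℝ) ≤ v / μ := by
    refine (ae_dirac_iff (measurableSet_le (by fun_prop) measurable_const)).2 ?_
    simpa using hvμ
  let ν : ℕ → ProbabilityMeasure State := fun n => evolveProb ω μ v n δ
  have hν : ∀ n, (ν n : Measure State) Kᶜ = 0 := fun n => by
    have := ae_evolve_le hω hμ hv (Nat.cast_nonneg n) hδ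
    refine measure_mono_null (fun z hz => ?_) (ae_iff.1 this)
    simp only [K, Set.mem_compl_iff, Set.mem_prod, Set.mem_univ, and_true] at hz
    exact fun h => hz h
  have hcomp : IsCompact {π : ProbabilityMeasure State | ∀ n : ℕ, π Kᶜ ≤ (fun _ => 0) n} :=
    isCompact_setOfPred_probabilityMeasure_mass_eq_compl_isCompact_le (K := fun _ => K)
      tendsto_const_nhds (fun _ => hK) (Or.inr fun _ _ _ => le_rfl)
  obtain ⟨π, -, hπ⟩ := hcomp.ultrafilter_le_nhds ((hyperfilter ℕ).map ν) (by
    rw [le_principal_iff]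
    refine Eventually.of_forall (f := (hyperfilter ℕ : Filter ℕ)) fun n _ => ?_
    simp [ProbabilityMeasure.coeFn_def, hν n])
  have hlim : Tendsto ν (hyperfilter ℕ) (𝓝 π) := hπ
  refine ⟨π, inferInstance, fun t ht => ?_⟩
  have h1 : Tendsto (fun n => evolveProb ω μ v t (ν n)) (hyperfilter ℕ)
      (𝓝 (evolveProb ω μ v t π)) := ((continuous_evolveProb ω μ v t).tendsto π).comp hlim
  have h2 := tendsto_mixedDist_evolve hω hμ hv (ae_evolve_le hω hμ hv ht hδ) hδ
  -- Commuting the two evolutions turns the contraction between the starts `δ P_t` and `δ` into one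
  -- between `ν n` evolved by `t` and `ν n`.
  have h3 : ∀ n : ℕ, evolve ω μ v (evolve ω μ v (δ : Measure State) t) n
      = (evolveProb ω μ v t (ν n) : Measure State) := fun n => by
    rw [evolve_evolve hω hμ v _ ht (Nat.cast_nonneg n), add_comm,
      ← evolve_evolve hω hμ v _ (Nat.cast_nonneg n) ht]
    rfl
  simp only [h3] at h2
  exact congrArg Subtype.val (eq_of_tendsto_of_mixedDist_tendsto h1 hlim
    (h2.mono_left Nat.hyperfilter_le_atTop))

/-! ### Rates -/

/-- The first rate is the harmonic mean of `μ` and `ω / p`. -/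
theorem rate_bounds {ω μ p : ℝ} (hω : 0 < ω) (hμ : 0 < μ) (hp : 1 ≤ p) :
    min μ (ω / p) ≤ 2 * ω * μ / (ω + p * μ) ∧ min μ (ω / p) ≤ 2 * ω := by
  have hp0 : 0 < p := by linarith
  have hωp : ω / p * p = ω := by field_simp
  constructor
  · rw [le_div_iff₀ (by positivity)]
    rcases le_total μ (ω / p) with h | h
    · rw [min_eq_left h]
      have := (le_div_iff₀ hp0).1 h
      nlinarith [mul_le_mul_of_nonneg_left this hμ.le]
    · rw [min_eq_right h]
      nlinarith [mul_le_mul_of_nonneg_left h hω.le]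
  · refine (min_le_right _ _).trans ((div_le_self hω.le hp).trans (by linarith))

theorem exp_rate_le {ω μ p s t : ℝ} (hω : 0 < ω) (hμ : 0 < μ) (hp : 1 ≤ p) (hs : 1 < s)
    (ht : 0 ≤ t) :
    Real.exp (-(2 * ω * μ / (ω + p * μ)) * t)
      ≤ Real.exp (-((2 * ω * μ / s) / (ω / s + p * μ)) * t) := by
  have hp0 : 0 < p := by linarith
  have hs0 : 0 < s := by linarith
  have : (2 * ω * μ / s) / (ω / s + p * μ) ≤ 2 * ω * μ / (ω + p * μ) := by
    rw [show (2 * ω * μ / s) / (ω / s + p * μ) = 2 * ω * μ / (ω + s * (p * μ)) by field_simp]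
    have : p * μ ≤ s * (p * μ) := le_mul_of_one_le_left (by positivity) hs.le
    gcongr
  rw [Real.exp_le_exp]
  nlinarith [mul_le_mul_of_nonneg_right this ht]

/-- A weakening of `mixedDist_evolve_le`: the constant, the moments and both exponentials all
increase. -/
theorem mixedDist_evolve_le_holder {ω μ v : ℝ} (hω : 0 < ω) (hμ : 0 < μ) (hv : 0 < v)
    {p q s : ℝ} (hp : 1 ≤ p) (hpq : p < q) (hs : 1 < s) (η η' : Measure State)
    [IsProbabilityMeasure η] [IsProbabilityMeasure η'] {t : ℝ} (ht : 0 ≤ t) :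
    mixedDist p (evolve ω μ v η t) (evolve ω μ v η' t)
      ≤ ENNReal.ofReal ((1 + (2 : ℝ) ^ (1 / s)) ^ (1 / p))
          * (momentF μ v q η + momentF μ v q η')
          * ENNReal.ofReal (Real.exp (-((2 * ω * μ / s) / (ω / s + p * μ)) * t))
        + ENNReal.ofReal (2 * Real.exp (-2 * ω * t)) := by
  have hp0 : 0 < p := by linarith
  have hvμ : 0 ≤ v / μ := by positivity
  refine (mixedDist_evolve_le hω hμ hv hp η η' ht).trans ?_
  have h2 : (1 : ℝ) ≤ 2 ^ (1 / s) := Real.one_le_rpow (by norm_num) (by positivity)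
  have h3 := exp_rate_le hω hμ hp hs ht
  have h4 := momentF_mono μ v hp0 hpq.le η hvμ
  have h5 := momentF_mono μ v hp0 hpq.le η' hvμ
  gcongr
  · linarith
  · linarith [Real.exp_pos (-2 * ω * t)]

theorem exists_mixedDist_le_exp {ω μ v : ℝ} (hω : 0 < ω) (hμ : 0 < μ) (hv : 0 < v)
    {π : Measure State} (hπ : IsInvariantProbability ω μ v π) {p : ℝ} (hp : 1 ≤ p) (z : State) :
    ∃ C : ℝ, 0 < C ∧ ∀ t : ℝ, 0 ≤ t → mixedDist p (evolve ω μ v (Measure.dirac z) t) π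
      ≤ ENNReal.ofReal (C * Real.exp (-min μ (ω / p) * t)) := by
  have := hπ.1
  have hp0 : 0 < p := by linarith
  set A := ENNReal.ofReal ((2 : ℝ) ^ (1 / p))
    * (momentF μ v p (Measure.dirac z) + momentF μ v p π) with hA
  have hAt : A ≠ ⊤ := by
    rw [hA, momentF_of_ae_le (by positivity) hp0 (ae_le_of_invariant hω hμ hv hπ)]
    exact ENNReal.mul_ne_top ENNReal.ofReal_ne_top
      (ENNReal.add_ne_top.2 ⟨momentF_dirac_ne_top μ v p hp0 z, ENNReal.ofReal_ne_top⟩)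
  refine ⟨A.toReal + 1, by positivity, fun t ht => ?_⟩
  have h := mixedDist_evolve_le hω hμ hv hp (Measure.dirac z) π ht
  rw [hπ.2 t ht, ← hA, ← ENNReal.ofReal_toReal hAt, ← ENNReal.ofReal_mul ENNReal.toReal_nonneg,
    ← ENNReal.ofReal_add (by positivity) (by positivity)] at h
  refine h.trans (ENNReal.ofReal_le_ofReal ?_)
  obtain ⟨h1, h2⟩ := rate_bounds hω hμ hp
  rw [add_mul, one_mul]
  gcongr
  linarith

theorem le_liminf_log {W : ℝ → ℝ≥0∞} {C r : ℝ} (hC : 0 < C)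
    (hW : ∀ t : ℝ, 0 ≤ t → W t ≤ ENNReal.ofReal (C * Real.exp (-r * t))) :
    (r : EReal) ≤ liminf (fun t : ℝ => ((-(1 / t) : ℝ) : EReal) * ENNReal.log (W t)) atTop := by
  have hlim : Tendsto (fun t : ℝ => ((r - Real.log C / t : ℝ) : EReal)) atTop (𝓝 (r : EReal)) := by
    refine (continuous_coe_real_ereal.tendsto r).comp ?_
    simpa using (tendsto_const_nhds (x := r)).sub
      (tendsto_const_nhds (x := Real.log C).div_atTop tendsto_id)
  rw [← hlim.liminf_eq]
  refine liminf_le_liminf ?_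
  filter_upwards [eventually_gt_atTop 0] with t ht
  -- Working in `EReal` covers `W t = 0`, where the logarithm is `⊥`.
  have h1 : ENNReal.log (W t) ≤ ((Real.log C - r * t : ℝ) : EReal) := by
    refine (ENNReal.log_monotone (hW t ht.le)).trans (le_of_eq ?_)
    rw [ENNReal.log_ofReal_of_pos (by positivity), Real.log_mul hC.ne' (Real.exp_pos _).ne',
      Real.log_exp]
    congr 1; ring
  have h2 : ((1 / t : ℝ) : EReal) * ENNReal.log (W t)
      ≤ ((1 / t : ℝ) : EReal) * ((Real.log C - r * t : ℝ) : EReal) :=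
    mul_le_mul_of_nonneg_left h1 (by exact_mod_cast (by positivity : (0 : ℝ) ≤ 1 / t))
  rw [EReal.coe_neg, EReal.neg_mul]
  refine le_trans (le_of_eq ?_) (EReal.neg_le_neg_iff.2 h2)
  rw [← EReal.coe_mul, ← EReal.coe_neg]
  congr 1
  field_simp
  ring

end HarmonicRTP

theorem mainTheorem5 (ω μ v : ℝ) (hω : 0 < ω) (hμ : 0 < μ) (hv : 0 < v) :
    (∀ (p q s : ℝ), 1 ≤ p → p < q → 1 < s → p / q + 1 / s = 1 →
      ∀ (η η' : Measure HarmonicRTP.State) [IsProbabilityMeasure η] [IsProbabilityMeasure η']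
        (t : ℝ), 0 ≤ t →
        HarmonicRTP.mixedDist p (HarmonicRTP.evolve ω μ v η t) (HarmonicRTP.evolve ω μ v η' t)
          ≤ ENNReal.ofReal ((1 + (2 : ℝ) ^ (1 / s)) ^ (1 / p))
              * (HarmonicRTP.momentF μ v q η + HarmonicRTP.momentF μ v q η')
              * ENNReal.ofReal (Real.exp (-((2 * ω * μ / s) / (ω / s + p * μ)) * t))
            + ENNReal.ofReal (2 * Real.exp (-2 * ω * t)))
    ∧ ∃ π : Measure HarmonicRTP.State,
        HarmonicRTP.IsInvariantProbability ω μ v π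
        ∧ (∀ π' : Measure HarmonicRTP.State,
            HarmonicRTP.IsInvariantProbability ω μ v π' → π' = π)
        ∧ (∀ (p q s : ℝ), 1 ≤ p → p < q → 1 < s → p / q + 1 / s = 1 →
            ∀ (η : Measure HarmonicRTP.State) [IsProbabilityMeasure η] (t : ℝ), 0 ≤ t →
              HarmonicRTP.mixedDist p (HarmonicRTP.evolve ω μ v η t) π
                ≤ ENNReal.ofReal ((1 + (2 : ℝ) ^ (1 / s)) ^ (1 / p))
                    * (HarmonicRTP.momentF μ v q η + ENNReal.ofReal (v / μ))
                    * ENNReal.ofReal (Real.exp (-((2 * ω * μ / s) / (ω / s + p * μ)) * t))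
                  + ENNReal.ofReal (2 * Real.exp (-2 * ω * t)))
        ∧ (∀ (p : ℝ), 1 ≤ p → ∀ z : HarmonicRTP.State,
            ((min μ (ω / p) : ℝ) : EReal)
              ≤ liminf (fun t : ℝ => ((-(1 / t) : ℝ) : EReal)
                  * ENNReal.log
                      (HarmonicRTP.mixedDist p (HarmonicRTP.evolve ω μ v (Measure.dirac z) t) π))
                atTop) := by
  refine ⟨fun p q s hp hpq hs _ η η' _ _ t ht =>
    HarmonicRTP.mixedDist_evolve_le_holder hω hμ hv hp hpq hs η η' ht, ?_⟩
  obtain ⟨π, hπ⟩ := HarmonicRTP.exists_invariant hω hμ hv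
  have := hπ.1
  refine ⟨π, hπ, fun π' hπ' => HarmonicRTP.invariant_unique hω hμ hv hπ hπ',
    fun p q s hp hpq hs _ η _ t ht => ?_, fun p hp z => ?_⟩
  · have h := HarmonicRTP.mixedDist_evolve_le_holder hω hμ hv hp hpq hs η π ht
    rwa [hπ.2 t ht, HarmonicRTP.momentF_of_ae_le (η := π) (by positivity) (by linarith)
      (HarmonicRTP.ae_le_of_invariant hω hμ hv hπ)] at h
  · obtain ⟨C, hC, hW⟩ := HarmonicRTP.exists_mixedDist_le_exp hω hμ hv hπ hp z
    exact HarmonicRTP.le_liminf_log hC hW
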